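/- Let $p$ be a prime, $k$ a perfect field of characteristic $p$, $\mathcal K=k((\tilde u))$, and $\mathcal K_{sep}$ a separable closure of $\mathcal K$ with valuation ring $O_{sep}$ and maximal ideal $\mathfrak m_{sep}$. Let $N\geqslant 1$ and $0\leqslant a\leqslant p-2$ be integers and put $a_N^*=(a+1)p^{N-1}-1$. **Lifts.** Let $W_N$ denote $p$-typical Witt vectors of length $N$, $\sigma$ the Frobenius, $u_N=[\tilde u]\in W_N(\mathcal K_{sep})$ the Teichmüller representative, and $u_m=F^{\circ (N-m)}(u_N)$ for $0\leqslant m\leqslant N$, where $F(X)=pX+X^p$. Put $t=p+u_1^{p-1}$, so that $u_0=tu_1$. Let $O_N(\mathcal K_{sep})=W_N(\sigma^{N-1}\mathcal K_{sep})[u_N]\subset W_N(\mathcal K_{sep})$, $O_N^0=O_N(\mathcal K_{sep})\cap W_N(O_{sep})$ and $O_N^+=O_N(\mathcal K_{sep})\cap W_N(\mathfrak m_{sep})$. **Filtered modules.** $\mathcal{MF}$ is the category of $W(k)$-modules $M$ with a decreasing filtration $M=M^0\supset\dots\supset M^{p-1}\supset M^p=0$ by submodules and $\sigma$-linear maps $\varphi_i:M^i\to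 M$ such that $\varphi_i|_{M^{i+1}}=p\varphi_{i+1}$. $\mathrm{MF}_N(a)$ is the full subcategory of those $M$ which have finite length over $W_N(k)$ (that is, have finite length over $W(k)$ and are killed by $p^N$), with $M^{a+1}=0$ and $\sum_i\operatorname{Im}\varphi_i=M$. The object $\mathcal S_a$ of $\mathcal{MF}$ is $O_N^0/u_0^aO_N^+$ with $\mathrm{Fil}^i\mathcal S_a=t^i\mathcal S_a$ for $0\leqslant i\leqslant a$, $\mathrm{Fil}^i\mathcal S_a=0$ for $i>a$, and the $\sigma$-linear $\varphi_i$ with $\varphi_i(t^i)=1$, i.e. $\varphi_i(t^ix)=\sigma(x)$. For $M\in\mathrm{MF}_N(a)$ put $\widetilde U_a(M)=\operatorname{Hom}_{\mathcal{MF}}(M,\mathcal S_a)$. **Ramification.** $\mathcal I_{\mathcal K}$ is the group of continuous automorphisms of the field $\mathcal K_{sep}$ which preserve the extension of the normalised valuation of $\mathcal K$ and act trivially on the residue field of $\mathcal K_{sep}$; they need not fix $\mathcal K$. For a finite extension $\mathcal E$ of $\mathcal K$ in $\mathcal K_{sep}$, let $v_{\mathcal E}$ be the extension to $\mathcal K_{sep}$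 of its normalised valuation, $\mathfrak m_{\mathcal E}$ its maximal ideal, and $\mathcal I_{\mathcal E/\mathcal K}$ the set of $\mathcal K$-embeddings $\mathcal E\to\mathcal K_{sep}$ which induce the identity on the residue field of $\mathcal E$. Let $\varphi_{\mathcal E/\mathcal K}(x)=\int_0^x n_{\mathcal E}(s)^{-1}ds$, where $n_{\mathcal E}(s)$ is the number of classes of $\mathcal I_{\mathcal E/\mathcal K}$ for the relation: $v_{\mathcal E}(\iota_1(c)-\iota_2(c))\geqslant 1+s$ for all $c\in\mathfrak m_{\mathcal E}$. Then $\mathcal I_{\mathcal K}^{(v)}$ is the subgroup of all $\tau\in\mathcal I_{\mathcal K}$ such that, for every such $\mathcal E$ and $x\geqslant 0$ with $\varphi_{\mathcal E/\mathcal K}(x)=v$, one has $v_{\mathcal E}(\tau(c)-c)\geqslant 1+x$ for all $c\in\mathfrak m_{\mathcal E}$. **Proposition.** Let $v>a_N^*$ be real and $M\in\mathrm{MF}_N(a)$. For $\tau\in\mathcal I_{\mathcal K}^{(v)}$ write $W_N(\tau)$ for the induced automorphism of $W_N(\mathcal K_{sep})$. 1. For every $\tau\in\mathcal I_{\mathcal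 K}^{(v)}$, the element $W_N(\tau)(u_0)$ is the product of $u_0$ and a unit of $O_N^0$. 2. For every $\tau\in\mathcal I_{\mathcal K}^{(v)}$ and $0\leqslant i\leqslant a$, the element $W_N(\tau)(t^i)$ lies in $O_N^0$, its class lies in $\mathrm{Fil}^i\mathcal S_a$, and $\varphi_i$ of this class is $1$. 3. The natural action of $\mathcal I_{\mathcal K}$ on $W_N(\mathcal K_{sep})$ induces an $\mathcal I_{\mathcal K}^{(v)}$-module structure on $\widetilde U_a(M)$: there is exactly one action of the group $\mathcal I_{\mathcal K}^{(v)}$ on the abelian group $\widetilde U_a(M)$ by additive maps such that for all $\tau\in\mathcal I_{\mathcal K}^{(v)}$, $\xi\in\widetilde U_a(M)$, $m\in M$, and all representatives $x,y\in O_N^0$ of $\xi(m)$ and $(\tau\xi)(m)$, $$W_N(\tau)(x)\equiv y \pmod{u_0^aW_N(\mathfrak m_{sep})}.$$ -/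

import Mathlib

set_option linter.unusedSectionVars false

open scoped LaurentSeries Witt

noncomputable section

namespace FLRam

/-! ### The valued field `k((u))` and its separable closure -/

/-- The embedding of value groups `exp (-n) ↦ 2 ^ (-n)`, turning the `u`-adic valuation of `k((u))`
into an absolute value. -/
@[reducible] def laurentRankOne (k : Type*) [Field k] :
    Valuation.RankOne (Valued.v : Valuation k⸨X⸩ (WithZero (Multiplicative ℤ))) where
  hom' := (WithZeroMulInt.toNNReal (two_ne_zero : (2 : NNReal) ≠ 0)).comp
    MonoidWithZeroHom.ValueGroup₀.embedding
  strictMono' := (WithZeroMulInt.toNNReal_strictMono (one_lt_two : (1 : NNReal) < 2)).comp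
    MonoidWithZeroHom.ValueGroup₀.embedding_strictMono
  exists_val_nontrivial := by
    refine ⟨HahnSeries.single 1 1, ?_, ?_⟩
    · rw [LaurentSeries.valuation_single_zpow]; simp
    · rw [LaurentSeries.valuation_single_zpow]; decide

/-- The absolute value `|f| = 2 ^ (-ord f)` on `k((u))`. -/
@[reducible] def laurentNormed (k : Type*) [Field k] : NontriviallyNormedField k⸨X⸩ :=
  letI := laurentRankOne k
  Valued.toNontriviallyNormedField k⸨X⸩ (WithZero (Multiplicative ℤ))

theorem laurentNormed_ultrametric (k : Type*) [Field k] :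
    letI := laurentNormed k
    IsUltrametricDist k⸨X⸩ := by
  let _ := laurentRankOne k
  let _ := Valued.toNormedField k⸨X⸩ (WithZero (Multiplicative ℤ))
  exact (inferInstance : IsUltrametricDist k⸨X⸩)

theorem laurentNormed_complete (k : Type*) [Field k] :
    letI := laurentNormed k
    CompleteSpace k⸨X⸩ :=
  LaurentSeries.instLaurentSeriesComplete

/-- The unique extension to the algebraic extension `Ksep` of the absolute value
`|f| = 2 ^ (-ord f)` of `K = k((u))`.  In terms of the extension `v` of the normalised
valuation of `K` one has `sepNorm k x = 2 ^ (-v x)`. -/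
def sepNorm (k : Type*) [Field k] {Ksep : Type*} [Field Ksep] [Algebra k⸨X⸩ Ksep]
    (x : Ksep) : ℝ :=
  letI := laurentNormed k
  spectralNorm k⸨X⸩ Ksep x

section Norm

variable (k : Type*) [Field k] {Ksep : Type*} [Field Ksep] [Algebra k⸨X⸩ Ksep]

theorem sepNorm_nonneg (x : Ksep) : 0 ≤ sepNorm k x :=
  let _ := laurentNormed k
  spectralNorm_nonneg x

theorem sepNorm_zero : sepNorm k (0 : Ksep) = 0 :=
  let _ := laurentNormed k
  spectralNorm_zero

theorem sepNorm_one : sepNorm k (1 : Ksep) = 1 :=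
  let _ := laurentNormed k
  spectralNorm_one

theorem sepNorm_algebraMap_of_ne_zero {f : k⸨X⸩} (hf : f ≠ 0) :
    sepNorm k (algebraMap k⸨X⸩ Ksep f) = 2 ^ (-f.order) := by
  let _ := laurentRankOne k
  let _ := laurentNormed k
  have h1 : sepNorm k (algebraMap k⸨X⸩ Ksep f) = ‖f‖ := spectralNorm_extends f
  have hvf : (Valued.v f : WithZero (Multiplicative ℤ)) ≠ 0 := (Valuation.ne_zero_iff _).2 hf
  have hv : (Valued.v f : WithZero (Multiplicative ℤ)) = WithZero.exp (-f.order) := by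
    apply le_antisymm
    · exact (LaurentSeries.valuation_le_iff_coeff_lt_eq_zero k).2
        fun n hn => HahnSeries.coeff_eq_zero_of_lt_order hn
    · obtain ⟨m, hm⟩ : ∃ m : ℤ, (Valued.v f : WithZero (Multiplicative ℤ)) = WithZero.exp (-m) :=
        ⟨-WithZero.log (Valued.v f), by rw [neg_neg, WithZero.exp_log hvf]⟩
      rw [hm, WithZero.exp_le_exp]
      by_contra hlt
      exact hf (HahnSeries.coeff_order_eq_zero.1
        ((LaurentSeries.valuation_le_iff_coeff_lt_eq_zero k).1 hm.le _ (by lia)))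
  have h2 : ‖f‖ = ((WithZeroMulInt.toNNReal (two_ne_zero : (2 : NNReal) ≠ 0)
      (Valued.v f) : NNReal) : ℝ) :=
    congrArg (fun z => ((WithZeroMulInt.toNNReal (two_ne_zero : (2 : NNReal) ≠ 0) z : NNReal) : ℝ))
      (MonoidWithZeroHom.ValueGroup₀.embedding_restrict₀ f)
  have h3 : ∀ (n : ℤ), ((WithZeroMulInt.toNNReal (two_ne_zero : (2 : NNReal) ≠ 0)
      (WithZero.exp n) : NNReal) : ℝ) = 2 ^ n := by
    intro n
    rw [WithZeroMulInt.toNNReal_neg_apply _ WithZero.exp_ne_zero]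
    have : WithZero.unzero (WithZero.exp_ne_zero (a := n)) = Multiplicative.ofAdd n :=
      WithZero.coe_inj.1 (WithZero.coe_unzero _)
    rw [this]
    simp
  rw [h1, h2, hv, h3]

variable [Algebra.IsAlgebraic k⸨X⸩ Ksep]

theorem sepNorm_mul (x y : Ksep) : sepNorm k (x * y) = sepNorm k x * sepNorm k y := by
  let _ := laurentNormed k
  have := laurentNormed_ultrametric k
  have := laurentNormed_complete k
  exact spectralAlgNorm_mul x y

theorem sepNorm_add_le (x y : Ksep) : sepNorm k (x + y) ≤ max (sepNorm k x) (sepNorm k y) := by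
  let _ := laurentNormed k
  have := laurentNormed_ultrametric k
  exact isNonarchimedean_spectralNorm x y

theorem sepNorm_neg (x : Ksep) : sepNorm k (-x) = sepNorm k x := by
  let _ := laurentNormed k
  have := laurentNormed_ultrametric k
  exact spectralNorm_neg (Algebra.IsAlgebraic.isAlgebraic x)

theorem sepNorm_sub_le (x y : Ksep) : sepNorm k (x - y) ≤ max (sepNorm k x) (sepNorm k y) := by
  rw [sub_eq_add_neg, ← sepNorm_neg k y]
  exact sepNorm_add_le k x (-y)

theorem sepNorm_pow (x : Ksep) (n : ℕ) : sepNorm k (x ^ n) = sepNorm k x ^ n := by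
  induction n with
  | zero => simp [sepNorm_one]
  | succ n ih => rw [pow_succ, pow_succ, sepNorm_mul, ih]

end Norm
/-! ### Ramification filtration -/

section Ramification

variable (k : Type*) [Field k] (Ksep : Type*) [Field Ksep] [Algebra k⸨X⸩ Ksep]
  [IsSepClosure k⸨X⸩ Ksep]

/-- The valuation ring `O_sep` of `Ksep`. -/
def intRing : Subring Ksep where
  carrier := {x | sepNorm k x ≤ 1}
  zero_mem' := by simp [sepNorm_zero]
  one_mem' := by simp [sepNorm_one]
  add_mem' {x y} hx hy := (sepNorm_add_le k x y).trans (max_le hx hy)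
  neg_mem' {x} hx := by
    simpa only [Set.mem_ofPred_eq, sepNorm_neg] using hx
  mul_mem' {x y} hx hy := by
    simpa only [Set.mem_ofPred_eq, sepNorm_mul] using mul_le_one₀ hx (sepNorm_nonneg k y) hy

/-- The maximal ideal `m_sep` of `O_sep`. -/
def maxIdeal : Ideal (intRing k Ksep) where
  carrier := {x | sepNorm k (x : Ksep) < 1}
  zero_mem' := by simp [sepNorm_zero]
  add_mem' {x y} hx hy := (sepNorm_add_le k (x : Ksep) y).trans_lt (max_lt hx hy)
  smul_mem' c x hx := by
    change sepNorm k ((c : Ksep) * x) < 1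
    rw [sepNorm_mul]
    exact mul_lt_one_of_nonneg_of_lt_one_right c.2 (sepNorm_nonneg k _) hx

/-- The group `I_K` of all automorphisms of the field `Ksep` which preserve the extension of the
normalised valuation of `K` and induce the identity on the residue field of `Ksep`.  Continuity is
automatic, since these are isometries.  They are not required to fix `K`. -/
def autGroup : Subgroup (RingAut Ksep) where
  carrier := {τ | (∀ x, sepNorm k (τ x) = sepNorm k x) ∧
    ∀ x, sepNorm k x ≤ 1 → sepNorm k (τ x - x) < 1}
  one_mem' := by simp [sepNorm_zero]
  mul_mem' {σ τ} hσ hτ := by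
    refine ⟨fun x => by rw [RingAut.mul_apply, hσ.1, hτ.1], fun x hx => ?_⟩
    have h : (σ * τ) x - x = σ (τ x - x) + (σ x - x) := by
      rw [RingAut.mul_apply, map_sub]; ring
    rw [h]
    refine (sepNorm_add_le k _ _).trans_lt (max_lt ?_ (hσ.2 x hx))
    rw [hσ.1]
    exact hτ.2 x hx
  inv_mem' {τ} hτ := by
    have h1 : ∀ x, τ (τ⁻¹ x) = x := fun x => by rw [← RingAut.mul_apply, mul_inv_cancel]; rfl
    have h2 : ∀ x, sepNorm k (τ⁻¹ x) = sepNorm k x := fun x => by rw [← hτ.1, h1]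
    refine ⟨h2, fun x hx => ?_⟩
    rw [← hτ.1, map_sub, h1, ← sepNorm_neg, neg_sub]
    exact hτ.2 x hx

variable {Ksep}

/-- `|ϖ_E|` for a uniformiser `ϖ_E` of the finite extension `E` of `K` inside `Ksep`.
Thus, with `v_E` the extension to `Ksep` of the normalised valuation of `E`,
`v_E x ≥ s` if and only if `sepNorm k x ≤ unifNorm k E ^ s`. -/
def unifNorm (E : IntermediateField k⸨X⸩ Ksep) : ℝ :=
  sSup {r | ∃ a ∈ E, sepNorm k a < 1 ∧ sepNorm k a = r}

/-- `τ ∈ I_{E,x}`: one has `v_E (τ a - a) ≥ 1 + x` for all `a` in the maximal ideal of `E`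
(for `τ` in `I_E = I_K`). -/
def LowerRam (E : IntermediateField k⸨X⸩ Ksep) (x : ℝ) (τ : RingAut Ksep) : Prop :=
  ∀ a ∈ E, sepNorm k a < 1 → sepNorm k (τ a - a) ≤ unifNorm k E ^ (1 + x)

/-- The set `I_{E/K}` of all `K`-embeddings of `E` into `Ksep` (they are automatically continuous)
which induce the identity on the residue field of `E`. -/
def RelEmb (E : IntermediateField k⸨X⸩ Ksep) : Type _ :=
  {ι : E →ₐ[k⸨X⸩] Ksep // ∀ a : E, sepNorm k (a : Ksep) ≤ 1 → sepNorm k (ι a - (a : Ksep)) < 1}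

/-- `x`-equivalence on `I_{E/K}`: `ι₁ ∼ ι₂` if and only if `v_E (ι₁ a - ι₂ a) ≥ 1 + x` for all `a`
in the maximal ideal of `E`. -/
def relEmbSetoid (E : IntermediateField k⸨X⸩ Ksep) (x : ℝ) : Setoid (RelEmb k E) where
  r ι₁ ι₂ := ∀ a : E, sepNorm k (a : Ksep) < 1 →
    sepNorm k (ι₁.1 a - ι₂.1 a) ≤ unifNorm k E ^ (1 + x)
  iseqv :=
    { refl := fun ι a _ => by
        rw [sub_self, sepNorm_zero]
        refine Real.rpow_nonneg (Real.sSup_nonneg ?_) _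
        rintro r ⟨b, -, -, rfl⟩
        exact sepNorm_nonneg k b
      symm := fun {ι₁ ι₂} h a ha => by
        rw [← sepNorm_neg, neg_sub]
        exact h a ha
      trans := fun {ι₁ ι₂ ι₃} h h' a ha => by
        rw [← sub_add_sub_cancel (ι₁.1 a) (ι₂.1 a) (ι₃.1 a)]
        exact (sepNorm_add_le k _ _).trans (max_le (h a ha) (h' a ha)) }

/-- The number `(I_{E/K} : I_{E/K,x})` of `x`-equivalence classes in `I_{E/K}`. -/
def relIndex (E : IntermediateField k⸨X⸩ Ksep) (x : ℝ) : ℕ :=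
  Nat.card (Quotient (relEmbSetoid k E x))

/-- The Herbrand function `φ_{E/K}(x) = ∫₀ˣ (I_{E/K} : I_{E/K,s})⁻¹ ds`. -/
def herbrand (E : IntermediateField k⸨X⸩ Ksep) (x : ℝ) : ℝ :=
  ∫ s in (0 : ℝ)..x, ((relIndex k E s : ℝ))⁻¹

variable (Ksep)

/-- The ramification subgroup `I_K^{(v)}` in upper numbering: all `τ ∈ I_K` such that for every
finite extension `E` of `K` in `Ksep` one has `τ ∈ I_{E,x}`, where `φ_{E/K}(x) = v`. -/
def ramGroup (v : ℝ) : Subgroup (RingAut Ksep) where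
  carrier := {τ | τ ∈ autGroup k Ksep ∧
    ∀ E : IntermediateField k⸨X⸩ Ksep, FiniteDimensional k⸨X⸩ E →
      ∀ x : ℝ, 0 ≤ x → herbrand k E x = v → LowerRam k E x τ}
  one_mem' := by
    refine ⟨one_mem _, fun E _ x _ _ a _ _ => ?_⟩
    rw [RingAut.one_apply, sub_self, sepNorm_zero]
    refine Real.rpow_nonneg (Real.sSup_nonneg ?_) _
    rintro r ⟨b, -, -, rfl⟩
    exact sepNorm_nonneg k b
  mul_mem' {σ τ} hσ hτ := by
    refine ⟨mul_mem hσ.1 hτ.1, fun E hE x hx hv a ha h => ?_⟩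
    have e : (σ * τ) a - a = σ (τ a - a) + (σ a - a) := by
      rw [RingAut.mul_apply, map_sub]; ring
    rw [e]
    refine (sepNorm_add_le k _ _).trans (max_le ?_ (hσ.2 E hE x hx hv a ha h))
    rw [hσ.1.1]
    exact hτ.2 E hE x hx hv a ha h
  inv_mem' {τ} hτ := by
    refine ⟨inv_mem hτ.1, fun E hE x hx hv a ha h => ?_⟩
    have h1 : τ (τ⁻¹ a) = a := by rw [← RingAut.mul_apply, mul_inv_cancel]; rfl
    rw [← hτ.1.1, map_sub, h1, ← sepNorm_neg, neg_sub]
    exact hτ.2 E hE x hx hv a ha h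

end Ramification

/-! ### Truncated Witt vectors and the lift of `Ksep` modulo `p ^ N` -/

section Witt

variable (p : ℕ) [Fact p.Prime] (N : ℕ)

/-- Functoriality of `W_N`: the homomorphism `W_N(R) → W_N(S)` applying `f` to each coordinate. -/
def twMap {R S : Type*} [CommRing R] [CommRing S] (f : R →+* S) :
    TruncatedWittVector p N R →+* TruncatedWittVector p N S :=
  RingHom.liftOfSurjective (WittVector.truncate N) (WittVector.truncate_surjective p N R)
    ⟨(WittVector.truncate N).comp (WittVector.map f), by
      intro x hx
      rw [WittVector.mem_ker_truncate] at hx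
      rw [RingHom.mem_ker, RingHom.comp_apply, ← RingHom.mem_ker, WittVector.mem_ker_truncate]
      intro i hi
      rw [WittVector.map_coeff, hx i hi, map_zero]⟩

variable {N}

theorem twMap_truncate {R S : Type*} [CommRing R] [CommRing S] (f : R →+* S) (x : WittVector p R) :
    twMap p N f (WittVector.truncate N x) = WittVector.truncate N (WittVector.map f x) :=
  RingHom.liftOfRightInverse_comp_apply _ _ _ _ x

theorem coeff_twMap {R S : Type*} [CommRing R] [CommRing S] (f : R →+* S)
    (x : TruncatedWittVector p N R) (i : Fin N) : (twMap p N f x).coeff i = f (x.coeff i) := by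
  obtain ⟨y, rfl⟩ := WittVector.truncate_surjective p N R x
  rw [twMap_truncate, WittVector.coeff_truncate, WittVector.coeff_truncate, WittVector.map_coeff]

end Witt

section LubinTate

/-- The power series `[p](X) = pX + X ^ p`, multiplication by `p` in the Lubin-Tate formal
group over `W(k)` that it determines, evaluated at `x`. -/
def lubinTateP (p : ℕ) {R : Type*} [CommRing R] (x : R) : R := p * x + x ^ p

theorem map_lubinTateP_iterate (p : ℕ) {R S : Type*} [CommRing R] [CommRing S] (f : R →+* S)
    (n : ℕ) (x : R) : f ((lubinTateP p)^[n] x) = (lubinTateP p)^[n] (f x) :=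
  (Function.Semiconj.iterate_right (f := f)
    (fun y => by simp only [lubinTateP, map_add, map_mul, map_pow, map_natCast]) n) x

theorem lubinTateP_congr (p : ℕ) {R : Type*} [CommRing R] {j : ℕ} (hj : 1 ≤ j) {x y : R}
    (h : (p : R) ^ j ∣ x - y) : (p : R) ^ (j + 1) ∣ lubinTateP p x - lubinTateP p y := by
  obtain ⟨w, hw⟩ := h
  obtain ⟨c, hc⟩ := Polynomial.powAddExpansion y (p ^ j * w) p
  have hx : x = y + p ^ j * w := by rw [← hw]; ring
  obtain ⟨i, rfl⟩ : ∃ i, j = i + 1 := ⟨j - 1, by omega⟩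
  rw [hx, lubinTateP, lubinTateP, hc]
  exact ⟨w + y ^ (p - 1) * w + c * p ^ i * w ^ 2, by ring⟩

theorem lubinTateP_iterate_congr (p : ℕ) {R : Type*} [CommRing R] {x y : R} (h : (p : R) ∣ x - y)
    (n : ℕ) : (p : R) ^ (n + 1) ∣ (lubinTateP p)^[n] x - (lubinTateP p)^[n] y := by
  induction n with
  | zero => simpa using h
  | succ n ih =>
    rw [Function.iterate_succ_apply', Function.iterate_succ_apply']
    exact lubinTateP_congr p (by omega) ih

end LubinTate

theorem natCast_pow_eq_zero (p : ℕ) [Fact p.Prime] (N : ℕ) (R : Type*) [CommRing R] [CharP R p] :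
    (p : TruncatedWittVector p N R) ^ N = 0 := by
  have h : (WittVector.truncate N ((p : WittVector p R) ^ N)) = 0 := by
    rw [← RingHom.mem_ker, WittVector.mem_ker_truncate]
    exact fun i hi => WittVector.coeff_p_pow_eq_zero p R hi.ne
  simpa using h

/-- The inclusion `k → K → Ksep` of the field of coefficients. -/
def constHom (k : Type*) [Field k] (Ksep : Type*) [Field Ksep] [Algebra k⸨X⸩ Ksep] : k →+* Ksep :=
  (algebraMap k⸨X⸩ Ksep).comp HahnSeries.C

theorem charP_sep (p : ℕ) (k : Type*) [Field k] [CharP k p] (Ksep : Type*) [Field Ksep]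
    [Algebra k⸨X⸩ Ksep] : CharP Ksep p :=
  charP_of_injective_ringHom (constHom k Ksep).injective p

section Lift

variable (p : ℕ) [Fact p.Prime] (k : Type*) [Field k] [CharP k p]
  (Ksep : Type*) [Field Ksep] [Algebra k⸨X⸩ Ksep]

/-- The Frobenius endomorphism `x ↦ x ^ p` of `Ksep`. -/
def frobSep : Ksep →+* Ksep :=
  have := charP_sep p k Ksep
  frobenius Ksep p

theorem frobSep_apply (x : Ksep) : frobSep p k Ksep x = x ^ p := rfl

variable (N : ℕ)

/-- The Frobenius endomorphism `σ` of `W_N(Ksep)`. -/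
def sigma : TruncatedWittVector p N Ksep →+* TruncatedWittVector p N Ksep :=
  twMap p N (frobSep p k Ksep)

/-- The element `u_N`: the Teichmüller representative of the uniformiser of `K` in `W_N(Ksep)`. -/
def uTop : TruncatedWittVector p N Ksep :=
  WittVector.truncate N
    (WittVector.teichmuller p (algebraMap k⸨X⸩ Ksep (HahnSeries.single 1 1)))

/-- The element `u_m = [p ^ (N - m)](u_N)` for `0 ≤ m ≤ N`. -/
def uElt (m : ℕ) : TruncatedWittVector p N Ksep :=
  (lubinTateP p)^[N - m] (uTop p k Ksep N)

/-- The element `t = u_0 / u_1 = p + u_1 ^ (p - 1)`. -/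
def tElt : TruncatedWittVector p N Ksep := p + uElt p k Ksep N 1 ^ (p - 1)

/-- The subring `O_N(Ksep) = W_N(σ ^ (N - 1) Ksep)[u_N]` of `W_N(Ksep)`. -/
def liftRing : Subring (TruncatedWittVector p N Ksep) :=
  Subring.closure (insert (uTop p k Ksep N)
    (Set.range (twMap p N (frobSep p k Ksep ^ (N - 1)))))

variable {N}

theorem sigma_uTop : sigma p k Ksep N (uTop p k Ksep N) = uTop p k Ksep N ^ p := by
  rw [sigma, uTop, twMap_truncate, WittVector.map_teichmuller, frobSep_apply, map_pow, map_pow]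

theorem sigma_uElt_one (hN : 1 ≤ N) :
    sigma p k Ksep N (uElt p k Ksep N 1) = uElt p k Ksep N 0 := by
  obtain ⟨n, rfl⟩ : ∃ n, N = n + 1 := ⟨N - 1, by omega⟩
  rw [uElt, uElt, map_lubinTateP_iterate, sigma_uTop, Nat.sub_zero, Nat.add_sub_cancel,
    Function.iterate_succ_apply, ← sub_eq_zero]
  have h := lubinTateP_iterate_congr p (x := uTop p k Ksep (n + 1) ^ p)
    (y := lubinTateP p (uTop p k Ksep (n + 1)))
    ⟨-uTop p k Ksep (n + 1), by rw [lubinTateP]; ring⟩ n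
  have := charP_sep p k Ksep
  rw [natCast_pow_eq_zero p (n + 1) Ksep] at h
  exact zero_dvd_iff.1 h

theorem isUnit_tElt : IsUnit (tElt p k Ksep N) := by
  have := charP_sep p k Ksep
  have hp : 2 ≤ p := (Fact.out : p.Prime).two_le
  let x : Ksep := algebraMap k⸨X⸩ Ksep (HahnSeries.single 1 1)
  have hx : x ≠ 0 := by simp [x]
  let T : WittVector p Ksep :=
    p + ((lubinTateP p)^[N - 1] (WittVector.teichmuller p x)) ^ (p - 1)
  have hT : tElt p k Ksep N = WittVector.truncate N T := by
    rw [tElt, uElt, uTop, map_add, map_pow, map_natCast, map_lubinTateP_iterate]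
  have h0 : ∀ n (y : Ksep), y ≠ 0 → (lubinTateP p)^[n] y ≠ 0 := by
    intro n
    induction n with
    | zero => exact fun y hy => hy
    | succ n ih =>
      intro y hy
      rw [Function.iterate_succ_apply]
      apply ih
      simpa [lubinTateP] using fun h => absurd h hy
  rw [hT]
  refine (WittVector.isUnit_of_coeff_zero_ne_zero T ?_).map _
  change WittVector.constantCoeff T ≠ 0
  rw [map_add, map_pow, map_natCast, map_lubinTateP_iterate, CharP.cast_eq_zero, zero_add]
  refine pow_ne_zero _ (h0 _ _ ?_)
  rw [show WittVector.constantCoeff (WittVector.teichmuller p x) = x from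
    WittVector.teichmuller_coeff_zero p x]
  exact hx

end Lift

theorem uElt_zero (p : ℕ) [Fact p.Prime] (k : Type*) [Field k] (Ksep : Type*) [Field Ksep]
    [Algebra k⸨X⸩ Ksep] {N : ℕ} (hN : 1 ≤ N) :
    uElt p k Ksep N 0 = tElt p k Ksep N * uElt p k Ksep N 1 := by
  obtain ⟨n, rfl⟩ : ∃ n, N = n + 1 := ⟨N - 1, by omega⟩
  have hp : p ≠ 0 := (Fact.out : p.Prime).ne_zero
  rw [tElt, uElt, uElt, Nat.sub_zero, Nat.add_sub_cancel, Function.iterate_succ_apply', add_mul,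
    pow_sub_one_mul hp]
  rfl


section Subrings

variable (p : ℕ) [Fact p.Prime] (k : Type*) [Field k]
  (Ksep : Type*) [Field Ksep] [Algebra k⸨X⸩ Ksep] [IsSepClosure k⸨X⸩ Ksep] (N : ℕ)

theorem mem_range_twMap_subtype {R : Type*} [CommRing R] (S : Subring R)
    (x : TruncatedWittVector p N R) :
    x ∈ (twMap p N S.subtype).range ↔ ∀ i, x.coeff i ∈ S := by
  constructor
  · rintro ⟨y, rfl⟩ i
    rw [coeff_twMap]
    exact (y.coeff i).2
  · intro h
    refine ⟨TruncatedWittVector.mk p fun i => ⟨x.coeff i, h i⟩, ?_⟩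
    ext i
    rw [coeff_twMap, TruncatedWittVector.coeff_mk]
    rfl

/-- The subring `W_N(O_sep)` of `W_N(Ksep)`: all coordinates lie in `O_sep`. -/
def wittInt : Subring (TruncatedWittVector p N Ksep) :=
  (twMap p N (intRing k Ksep).subtype).range.copy {x | ∀ i, sepNorm k (x.coeff i) ≤ 1} <| by
    ext x
    exact (mem_range_twMap_subtype p N (intRing k Ksep) x).symm

theorem mem_wittInt {x : TruncatedWittVector p N Ksep} :
    x ∈ wittInt p k Ksep N ↔ ∀ i, sepNorm k (x.coeff i) ≤ 1 := Iff.rfl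

theorem mem_wittMax_aux (x : TruncatedWittVector p N Ksep) :
    x ∈ ((RingHom.ker (twMap p N (Ideal.Quotient.mk (maxIdeal k Ksep)))).toAddSubgroup.map
      (twMap p N (intRing k Ksep).subtype).toAddMonoidHom) ↔
    ∀ i, sepNorm k (x.coeff i) < 1 := by
  rw [AddSubgroup.mem_map]
  constructor
  · rintro ⟨y, hy, rfl⟩ i
    have hy' : twMap p N (Ideal.Quotient.mk (maxIdeal k Ksep)) y = 0 := hy
    have h := coeff_twMap p (Ideal.Quotient.mk (maxIdeal k Ksep)) y i
    rw [hy', TruncatedWittVector.coeff_zero] at h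
    have h' : y.coeff i ∈ maxIdeal k Ksep := Ideal.Quotient.eq_zero_iff_mem.1 h.symm
    change sepNorm k ((twMap p N (intRing k Ksep).subtype y).coeff i) < 1
    rw [coeff_twMap]
    exact h'
  · intro h
    refine ⟨TruncatedWittVector.mk p fun i => ⟨x.coeff i, (h i).le⟩, ?_, ?_⟩
    · change twMap p N (Ideal.Quotient.mk (maxIdeal k Ksep)) _ = 0
      ext i
      rw [coeff_twMap, TruncatedWittVector.coeff_mk, TruncatedWittVector.coeff_zero,
        Ideal.Quotient.eq_zero_iff_mem]
      exact h i
    · ext i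
      change (twMap p N (intRing k Ksep).subtype _).coeff i = _
      rw [coeff_twMap, TruncatedWittVector.coeff_mk]
      rfl

/-- The ideal `W_N(m_sep)` of `W_N(O_sep)`, as an additive subgroup of `W_N(Ksep)`: all coordinates
lie in `m_sep`. -/
def wittMax : AddSubgroup (TruncatedWittVector p N Ksep) :=
  ((RingHom.ker (twMap p N (Ideal.Quotient.mk (maxIdeal k Ksep)))).toAddSubgroup.map
    (twMap p N (intRing k Ksep).subtype).toAddMonoidHom).copy
    {x | ∀ i, sepNorm k (x.coeff i) < 1} <| by
    ext x
    exact (mem_wittMax_aux p k Ksep N x).symm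

variable {p k Ksep N}

theorem mem_wittMax {x : TruncatedWittVector p N Ksep} :
    x ∈ wittMax p k Ksep N ↔ ∀ i, sepNorm k (x.coeff i) < 1 := Iff.rfl

theorem wittMax_le_wittInt {x : TruncatedWittVector p N Ksep} (hx : x ∈ wittMax p k Ksep N) :
    x ∈ wittInt p k Ksep N := fun i => (hx i).le

theorem mul_mem_wittMax {x y : TruncatedWittVector p N Ksep} (hx : x ∈ wittInt p k Ksep N)
    (hy : y ∈ wittMax p k Ksep N) : x * y ∈ wittMax p k Ksep N := by
  have hx' := (mem_range_twMap_subtype p N (intRing k Ksep) x).2 hx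
  obtain ⟨x', rfl⟩ := hx'
  have hy' := (mem_wittMax_aux p k Ksep N y).2 hy
  obtain ⟨y', hy', rfl⟩ := hy'
  refine (mem_wittMax_aux p k Ksep N _).1 ⟨x' * y', ?_, ?_⟩
  · exact Ideal.mul_mem_left _ x' hy'
  · exact map_mul (twMap p N (intRing k Ksep).subtype) x' y'

theorem uTop_mem_wittMax : uTop p k Ksep N ∈ wittMax p k Ksep N := by
  intro i
  rw [uTop, WittVector.coeff_truncate]
  rcases Nat.eq_zero_or_pos (i : ℕ) with hi | hi
  · rw [hi, WittVector.teichmuller_coeff_zero, sepNorm_algebraMap_of_ne_zero k (by simp),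
      HahnSeries.order_single one_ne_zero]
    norm_num
  · rw [WittVector.teichmuller_coeff_pos p _ _ hi, sepNorm_zero]
    exact one_pos

theorem lubinTateP_mem_wittMax {x : TruncatedWittVector p N Ksep}
    (hx : x ∈ wittMax p k Ksep N) : lubinTateP p x ∈ wittMax p k Ksep N := by
  have hp : p ≠ 0 := (Fact.out : p.Prime).ne_zero
  refine add_mem (mul_mem_wittMax (natCast_mem _ p) hx) ?_
  rw [← pow_sub_one_mul hp]
  exact mul_mem_wittMax (pow_mem (wittMax_le_wittInt hx) _) hx

theorem uElt_mem_wittMax (m : ℕ) : uElt p k Ksep N m ∈ wittMax p k Ksep N := by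
  rw [uElt]
  induction N - m with
  | zero => exact uTop_mem_wittMax
  | succ n ih =>
    rw [Function.iterate_succ_apply']
    exact lubinTateP_mem_wittMax ih

variable [CharP k p]

theorem uElt_mem_liftRing (m : ℕ) : uElt p k Ksep N m ∈ liftRing p k Ksep N := by
  rw [uElt]
  induction N - m with
  | zero => exact Subring.subset_closure (Set.mem_insert _ _)
  | succ n ih =>
    rw [Function.iterate_succ_apply']
    exact add_mem (mul_mem (natCast_mem _ p) ih) (pow_mem ih p)

theorem frobSep_pow_apply (n : ℕ) (x : Ksep) : (frobSep p k Ksep ^ n) x = x ^ p ^ n := by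
  induction n generalizing x with
  | zero => simp
  | succ n ih =>
    rw [pow_succ, RingHom.mul_def, RingHom.comp_apply, ih, frobSep_apply, ← pow_mul, pow_succ']

theorem sigma_mem_liftRing {x : TruncatedWittVector p N Ksep} (hx : x ∈ liftRing p k Ksep N) :
    sigma p k Ksep N x ∈ liftRing p k Ksep N := by
  suffices h : liftRing p k Ksep N ≤ (liftRing p k Ksep N).comap (sigma p k Ksep N) from h hx
  refine (Subring.closure_le).2 ?_
  rintro y (rfl | ⟨z, rfl⟩)
  · change sigma p k Ksep N (uTop p k Ksep N) ∈ liftRing p k Ksep N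
    rw [sigma_uTop]
    exact pow_mem (Subring.subset_closure (Set.mem_insert _ _)) p
  · refine Subring.subset_closure (Set.mem_insert_of_mem _ ⟨sigma p k Ksep N z, ?_⟩)
    ext i
    rw [sigma, coeff_twMap, coeff_twMap, coeff_twMap, coeff_twMap, frobSep_pow_apply,
      frobSep_pow_apply, frobSep_apply, frobSep_apply, ← pow_mul, ← pow_mul, mul_comm]

theorem sigma_mem_wittInt {x : TruncatedWittVector p N Ksep} (hx : x ∈ wittInt p k Ksep N) :
    sigma p k Ksep N x ∈ wittInt p k Ksep N := by
  intro i
  rw [sigma, coeff_twMap, frobSep_apply, sepNorm_pow]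
  exact pow_le_one₀ (sepNorm_nonneg k _) (hx i)

theorem sigma_mem_wittMax {x : TruncatedWittVector p N Ksep} (hx : x ∈ wittMax p k Ksep N) :
    sigma p k Ksep N x ∈ wittMax p k Ksep N := by
  intro i
  rw [sigma, coeff_twMap, frobSep_apply, sepNorm_pow]
  exact pow_lt_one₀ (sepNorm_nonneg k _) (hx i) (Fact.out : p.Prime).ne_zero

variable (p k Ksep N)

/-- The ring `O_N^0 = O_N(Ksep) ∩ W_N(O_sep)`. -/
def liftInt : Subring (TruncatedWittVector p N Ksep) := liftRing p k Ksep N ⊓ wittInt p k Ksep N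

/-- The ideal `O_N^+ = O_N(Ksep) ∩ W_N(m_sep)` of `O_N^0`. -/
def liftPlus : Ideal (liftInt p k Ksep N) where
  carrier := {x | (x : TruncatedWittVector p N Ksep) ∈ wittMax p k Ksep N}
  zero_mem' := zero_mem (wittMax p k Ksep N)
  add_mem' hx hy := (wittMax p k Ksep N).add_mem hx hy
  smul_mem' c _ hx := mul_mem_wittMax c.2.2 hx

/-- The elements `u_m`, regarded as elements of `O_N^0`. -/
def uInt (m : ℕ) : liftInt p k Ksep N :=
  ⟨uElt p k Ksep N m, uElt_mem_liftRing m, wittMax_le_wittInt (uElt_mem_wittMax m)⟩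

/-- The element `t`, regarded as an element of `O_N^0`. -/
def tInt : liftInt p k Ksep N := p + uInt p k Ksep N 1 ^ (p - 1)

theorem coe_tInt : (tInt p k Ksep N : TruncatedWittVector p N Ksep) = tElt p k Ksep N := by
  simp [tInt, tElt, uInt]

/-- The Frobenius endomorphism `σ` of `O_N^0`. -/
def sigmaInt : liftInt p k Ksep N →+* liftInt p k Ksep N :=
  (sigma p k Ksep N).restrict _ _ fun _ hx => ⟨sigma_mem_liftRing hx.1, sigma_mem_wittInt hx.2⟩

variable [PerfectRing k p]

/-- The structure homomorphism `W(k) → W_N(k) → O_N^0`. -/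
def coeffHom : WittVector p k →+* liftInt p k Ksep N :=
  ((WittVector.truncate N).comp (WittVector.map (constHom k Ksep))).codRestrict _ <| by
    intro w
    refine ⟨Subring.subset_closure (Set.mem_insert_of_mem _ ?_), fun i => ?_⟩
    · refine ⟨WittVector.truncate N (WittVector.map ((constHom k Ksep).comp
        ((iterateFrobeniusEquiv k p (N - 1)).symm : k →+* k)) w), ?_⟩
      ext i
      rw [coeff_twMap, RingHom.comp_apply, WittVector.coeff_truncate, WittVector.coeff_truncate,
        WittVector.map_coeff, WittVector.map_coeff, frobSep_pow_apply, RingHom.comp_apply,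
        ← map_pow]
      congr 1
      rw [← iterateFrobenius_def]
      exact (iterateFrobeniusEquiv k p (N - 1)).apply_symm_apply _
    · rw [RingHom.comp_apply, WittVector.coeff_truncate, WittVector.map_coeff]
      by_cases hc : w.coeff i = 0
      · rw [hc, map_zero, sepNorm_zero]; exact zero_le_one
      · rw [constHom, RingHom.comp_apply, sepNorm_algebraMap_of_ne_zero k (by simpa using hc)]
        rw [HahnSeries.C_apply, HahnSeries.order_single hc]
        simp

instance liftIntAlgebra : Algebra (WittVector p k) (liftInt p k Ksep N) :=
  (coeffHom p k Ksep N).toAlgebra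

theorem sigmaInt_coeffHom (w : WittVector p k) :
    sigmaInt p k Ksep N (coeffHom p k Ksep N w) =
      coeffHom p k Ksep N (WittVector.frobenius w) := by
  apply Subtype.ext
  change sigma p k Ksep N (WittVector.truncate N (WittVector.map (constHom k Ksep) w)) =
    WittVector.truncate N (WittVector.map (constHom k Ksep) (WittVector.frobenius w))
  ext i
  rw [sigma, coeff_twMap, WittVector.coeff_truncate, WittVector.coeff_truncate,
    WittVector.map_coeff, WittVector.map_coeff, WittVector.coeff_frobenius_charP, frobSep_apply,
    map_pow]

end Subrings

/-! ### Filtered modules -/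

section FilteredModules

/-- An object of the category `MF` with underlying `W(k)`-module `M`: a decreasing filtration
`M = M^0 ⊇ ... ⊇ M^(p-1) ⊇ M^p = 0` by `W(k)`-submodules, with `σ`-linear maps `φ_i : M^i → M` such
that the restriction of `φ_i` to `M^(i+1)` is `p φ_(i+1)`.  (For `i ≥ p` one has `M^i = 0`.) -/
structure FilteredModule (p : ℕ) [Fact p.Prime] (k : Type*) [Field k] (M : Type*) [AddCommGroup M]
    [Module (WittVector p k) M] where
  fil : ℕ → Submodule (WittVector p k) M
  fil_zero : fil 0 = ⊤
  fil_succ_le : ∀ i, fil (i + 1) ≤ fil i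
  fil_p : fil p = ⊥
  phi : ∀ i, fil i →ₛₗ[(WittVector.frobenius : WittVector p k →+* WittVector p k)] M
  phi_compat : ∀ i (m : M) (h : m ∈ fil (i + 1)),
    phi i ⟨m, fil_succ_le i h⟩ = p • phi (i + 1) ⟨m, h⟩

variable {p : ℕ} [Fact p.Prime] {k : Type*} [Field k]

/-- The property of being a Fontaine-Laffaille module in `MF_N(a)`: finite length over `W_N(k)`,
that is, finite length over `W(k)` and killed by `p ^ N`, with `M^(a+1) = 0` and
`∑ i, Im φ_i = M`. -/
structure FilteredModule.IsFontaineLaffaille {M : Type*} [AddCommGroup M]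
    [Module (WittVector p k) M] (A : FilteredModule p k M) (N a : ℕ) : Prop where
  finite_length : IsFiniteLength (WittVector p k) M
  torsion : ∀ m : M, p ^ N • m = 0
  fil_eq_bot : A.fil (a + 1) = ⊥
  span_range : Submodule.span (WittVector p k) (⋃ i, Set.range (A.phi i)) = ⊤

/-- The group `Hom_MF(A, B)`: `W(k)`-linear maps respecting the filtrations and commuting
with all `φ_i`. -/
def mfHom {M M' : Type*} [AddCommGroup M] [Module (WittVector p k) M] [AddCommGroup M']
    [Module (WittVector p k) M'] (A : FilteredModule p k M) (B : FilteredModule p k M') :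
    AddSubgroup (M →ₗ[WittVector p k] M') where
  carrier := {ξ | ∃ h : ∀ i, ∀ m ∈ A.fil i, ξ m ∈ B.fil i,
    ∀ i (m : A.fil i), ξ (A.phi i m) = B.phi i ⟨ξ m, h i m m.2⟩}
  zero_mem' := ⟨fun i m _ => zero_mem _, fun i m => (map_zero (B.phi i)).symm⟩
  add_mem' := by
    rintro ξ η ⟨h, h'⟩ ⟨g, g'⟩
    refine ⟨fun i m hm => add_mem (h i m hm) (g i m hm), fun i m => ?_⟩
    rw [LinearMap.add_apply, h', g', ← map_add]
    rfl
  neg_mem' := by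
    rintro ξ ⟨h, h'⟩
    refine ⟨fun i m hm => neg_mem (h i m hm), fun i m => ?_⟩
    rw [LinearMap.neg_apply, h', ← map_neg]
    rfl

end FilteredModules

section Sa

variable (p : ℕ) [Fact p.Prime] (k : Type*) [Field k] [CharP k p] [PerfectRing k p]
  (Ksep : Type*) [Field Ksep] [Algebra k⸨X⸩ Ksep] [IsSepClosure k⸨X⸩ Ksep] (N a : ℕ)

/-- The ideal `u_0 ^ a O_N^+` of `O_N^0`. -/
def saIdeal : Ideal (liftInt p k Ksep N) :=
  Ideal.span {uInt p k Ksep N 0 ^ a} * liftPlus p k Ksep N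

/-- The `W(k)`-module (and ring) `S_a = O_N^0 / u_0 ^ a O_N^+`. -/
abbrev Sa : Type _ := liftInt p k Ksep N ⧸ saIdeal p k Ksep N a

/-- The projection `O_N^0 → S_a`. -/
def saMk : liftInt p k Ksep N →ₐ[WittVector p k] Sa p k Ksep N a :=
  Ideal.Quotient.mkₐ (WittVector p k) (saIdeal p k Ksep N a)

variable {p k Ksep N a}

theorem saMk_eq_zero {x : liftInt p k Ksep N} : saMk p k Ksep N a x = 0 ↔
    ∃ y ∈ liftPlus p k Ksep N, uInt p k Ksep N 0 ^ a * y = x := by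
  change Ideal.Quotient.mk (saIdeal p k Ksep N a) x = 0 ↔ _
  rw [Ideal.Quotient.eq_zero_iff_mem, saIdeal, Ideal.mem_span_singleton_mul]

theorem saMk_surjective : Function.Surjective (saMk p k Ksep N a) :=
  Ideal.Quotient.mk_surjective

theorem uInt_zero (hN : 1 ≤ N) : uInt p k Ksep N 0 = tInt p k Ksep N * uInt p k Ksep N 1 :=
  Subtype.ext <| by
    rw [Subring.coe_mul, coe_tInt]
    exact uElt_zero p k Ksep hN

theorem sigmaInt_uInt_one (hN : 1 ≤ N) :
    sigmaInt p k Ksep N (uInt p k Ksep N 1) = uInt p k Ksep N 0 :=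
  Subtype.ext (sigma_uElt_one p k Ksep hN)

theorem sigmaInt_tInt (hN : 1 ≤ N) :
    sigmaInt p k Ksep N (tInt p k Ksep N) = p + uInt p k Ksep N 0 ^ (p - 1) := by
  rw [tInt, map_add, map_pow, map_natCast, sigmaInt_uInt_one hN]

theorem sigmaInt_mem_liftPlus {x : liftInt p k Ksep N} (hx : x ∈ liftPlus p k Ksep N) :
    sigmaInt p k Ksep N x ∈ liftPlus p k Ksep N := sigma_mem_wittMax (k := k) hx

/-- `φ_i` is well defined: if `t ^ i x ∈ u_0 ^ a O_N^+` then `σ x ∈ u_0 ^ a O_N^+`. -/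
theorem saMk_sigmaInt_eq_zero (hN : 1 ≤ N) {i : ℕ} (hi : i ≤ a) {x : liftInt p k Ksep N}
    (hx : saMk p k Ksep N a (tInt p k Ksep N ^ i * x) = 0) :
    saMk p k Ksep N a (sigmaInt p k Ksep N x) = 0 := by
  obtain ⟨y, hy, h⟩ := saMk_eq_zero.1 hx
  obtain ⟨j, rfl⟩ := Nat.exists_eq_add_of_le hi
  have hx' : x = tInt p k Ksep N ^ j * uInt p k Ksep N 1 ^ (i + j) * y := by
    have ht := (isUnit_tElt p k Ksep (N := N)).pow i
    rw [← coe_tInt, ← SubmonoidClass.coe_pow] at ht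
    have e : tInt p k Ksep N ^ i * x =
        tInt p k Ksep N ^ i * (tInt p k Ksep N ^ j * uInt p k Ksep N 1 ^ (i + j) * y) := by
      rw [← h, uInt_zero hN]
      ring
    exact Subtype.ext (ht.mul_left_cancel (congrArg Subtype.val e))
  refine saMk_eq_zero.2 ⟨sigmaInt p k Ksep N (tInt p k Ksep N) ^ j * sigmaInt p k Ksep N y,
    Ideal.mul_mem_left _ _ (sigmaInt_mem_liftPlus hy), ?_⟩
  rw [hx', map_mul, map_mul, map_pow, map_pow, sigmaInt_uInt_one hN]
  ring

variable (p k Ksep N a)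

/-- The filtration of `S_a`: `Fil^i S_a = t ^ i S_a` for `0 ≤ i ≤ a`, and `Fil^i S_a = 0`
for `i > a`. -/
def saFil (i : ℕ) : Submodule (WittVector p k) (Sa p k Ksep N a) :=
  if i ≤ a then
    LinearMap.range (LinearMap.mulLeft (WittVector p k) (saMk p k Ksep N a (tInt p k Ksep N ^ i)))
  else ⊥

variable {p k Ksep N a}

theorem mem_saFil {i : ℕ} (hi : i ≤ a) {s : Sa p k Ksep N a} : s ∈ saFil p k Ksep N a i ↔
    ∃ x : liftInt p k Ksep N, saMk p k Ksep N a (tInt p k Ksep N ^ i * x) = s := by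
  rw [saFil, if_pos hi, LinearMap.mem_range]
  constructor
  · rintro ⟨y, rfl⟩
    obtain ⟨x, rfl⟩ := saMk_surjective y
    exact ⟨x, map_mul _ _ _⟩
  · rintro ⟨x, rfl⟩
    exact ⟨saMk p k Ksep N a x, (map_mul _ _ _).symm⟩

theorem eq_zero_of_mem_saFil {i : ℕ} (hi : a < i) {s : Sa p k Ksep N a}
    (hs : s ∈ saFil p k Ksep N a i) : s = 0 := by
  rw [saFil, if_neg (by omega)] at hs
  exact hs

theorem exists_saPhi (hN : 1 ≤ N) (i : ℕ) (s : saFil p k Ksep N a i) :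
    ∃ r : Sa p k Ksep N a, (a < i → r = 0) ∧ (i ≤ a → ∀ x : liftInt p k Ksep N,
      saMk p k Ksep N a (tInt p k Ksep N ^ i * x) = s →
        saMk p k Ksep N a (sigmaInt p k Ksep N x) = r) := by
  by_cases hi : i ≤ a
  · obtain ⟨y, hy⟩ := (mem_saFil hi).1 s.2
    refine ⟨saMk p k Ksep N a (sigmaInt p k Ksep N y), fun h => absurd hi (by omega),
      fun _ x hx => ?_⟩
    rw [← sub_eq_zero, ← map_sub, ← map_sub]
    apply saMk_sigmaInt_eq_zero hN hi
    rw [mul_sub, map_sub, hx, hy, sub_self]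
  · exact ⟨0, fun _ => rfl, fun h => absurd h hi⟩

/-- The underlying function of `φ_i : Fil^i S_a → S_a`: for `i ≤ a` it sends `t ^ i x` to `σ x`;
it is zero on `Fil^i S_a = 0` if `i > a`. -/
def saPhiFun (hN : 1 ≤ N) (i : ℕ) (s : saFil p k Ksep N a i) : Sa p k Ksep N a :=
  (exists_saPhi hN i s).choose

theorem saPhiFun_of_lt (hN : 1 ≤ N) {i : ℕ} (hi : a < i) (s : saFil p k Ksep N a i) :
    saPhiFun hN i s = 0 :=
  (exists_saPhi hN i s).choose_spec.1 hi

theorem saPhiFun_eq (hN : 1 ≤ N) {i : ℕ} (hi : i ≤ a) (s : saFil p k Ksep N a i)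
    (x : liftInt p k Ksep N) (hx : saMk p k Ksep N a (tInt p k Ksep N ^ i * x) = s) :
    saPhiFun hN i s = saMk p k Ksep N a (sigmaInt p k Ksep N x) :=
  ((exists_saPhi hN i s).choose_spec.2 hi x hx).symm

/-- The `σ`-linear map `φ_i : Fil^i S_a → S_a` with `φ_i (t ^ i x) = σ x`; in particular
`φ_i (t ^ i) = 1`. -/
def saPhi (hN : 1 ≤ N) (i : ℕ) : saFil p k Ksep N a i
    →ₛₗ[(WittVector.frobenius : WittVector p k →+* WittVector p k)] Sa p k Ksep N a where
  toFun := saPhiFun hN i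
  map_add' s s' := by
    by_cases hi : i ≤ a
    · obtain ⟨x, hx⟩ := (mem_saFil hi).1 s.2
      obtain ⟨x', hx'⟩ := (mem_saFil hi).1 s'.2
      rw [saPhiFun_eq hN hi s x hx, saPhiFun_eq hN hi s' x' hx',
        saPhiFun_eq hN hi (s + s') (x + x')
          (by rw [mul_add, map_add, hx, hx', Submodule.coe_add]), map_add, map_add]
    · simp only [saPhiFun_of_lt hN (not_le.1 hi), add_zero]
  map_smul' w s := by
    by_cases hi : i ≤ a
    · obtain ⟨x, hx⟩ := (mem_saFil hi).1 s.2
      rw [saPhiFun_eq hN hi s x hx, saPhiFun_eq hN hi (w • s) (w • x)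
          (by rw [mul_smul_comm, map_smul, hx, Submodule.coe_smul]), ← map_smul]
      congr 1
      rw [Algebra.smul_def, Algebra.smul_def, map_mul]
      congr 1
      exact sigmaInt_coeffHom p k Ksep N w
    · simp only [saPhiFun_of_lt hN (not_le.1 hi), smul_zero]

variable (p k Ksep)

/-- The filtered module `S_a` for `0 ≤ a ≤ p - 2`, as an object of the category `MF`. -/
def saMF (hN : 1 ≤ N) (ha : a + 2 ≤ p) : FilteredModule p k (Sa p k Ksep N a) where
  fil := saFil p k Ksep N a
  fil_zero := by
    rw [eq_top_iff]
    intro s _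
    obtain ⟨x, rfl⟩ := saMk_surjective s
    exact (mem_saFil (Nat.zero_le a)).2 ⟨x, by rw [pow_zero, one_mul]⟩
  fil_succ_le i := by
    intro s hs
    by_cases hi : i + 1 ≤ a
    · obtain ⟨x, rfl⟩ := (mem_saFil hi).1 hs
      exact (mem_saFil (by omega)).2 ⟨tInt p k Ksep N * x, by rw [pow_succ, mul_assoc]⟩
    · rw [eq_zero_of_mem_saFil (by omega) hs]
      exact zero_mem _
  fil_p := by rw [saFil, if_neg (by omega)]
  phi := saPhi hN
  phi_compat i s hs := by
    change saPhiFun hN i _ = p • saPhiFun hN (i + 1) _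
    by_cases hi : i + 1 ≤ a
    · obtain ⟨x, hx⟩ := (mem_saFil hi).1 hs
      rw [saPhiFun_eq hN hi _ x hx, saPhiFun_eq hN (by omega) _ (tInt p k Ksep N * x)
        ((congrArg _ (by ring)).trans hx), ← map_nsmul, ← sub_eq_zero, ← map_sub, map_mul,
        sigmaInt_tInt hN, nsmul_eq_mul]
      obtain ⟨b, hb⟩ : ∃ b, p - 1 = a + (b + 1) := ⟨p - 1 - a - 1, by omega⟩
      refine saMk_eq_zero.2 ⟨uInt p k Ksep N 0 ^ b * sigmaInt p k Ksep N x * uInt p k Ksep N 0,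
        Ideal.mul_mem_left _ _ (uElt_mem_wittMax 0), ?_⟩
      rw [hb]
      ring
    · have h0 : s = 0 := eq_zero_of_mem_saFil (by omega) hs
      subst h0
      rw [saPhiFun_of_lt hN (not_le.1 hi), smul_zero]
      exact map_zero (saPhi hN i)

/-- The group `Ũ_a(M) = Hom_MF(M, S_a)`. -/
abbrev UTilde (hN : 1 ≤ N) (ha : a + 2 ≤ p) {M : Type*} [AddCommGroup M]
    [Module (WittVector p k) M] (A : FilteredModule p k M) :
    AddSubgroup (M →ₗ[WittVector p k] Sa p k Ksep N a) :=
  mfHom A (saMF p k Ksep hN ha)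

end Sa

section Action

variable (p : ℕ) [Fact p.Prime] {Ksep : Type*} [Field Ksep] (N : ℕ)

/-- The natural action of automorphisms of `Ksep` on `W_N(Ksep)`, coordinate by coordinate. -/
def wittAct (τ : RingAut Ksep) : TruncatedWittVector p N Ksep →+* TruncatedWittVector p N Ksep :=
  twMap p N (τ : Ksep →+* Ksep)

theorem coeff_wittAct (τ : RingAut Ksep) (x : TruncatedWittVector p N Ksep) (i : Fin N) :
    (wittAct p N τ x).coeff i = τ (x.coeff i) :=
  coeff_twMap p _ x i

end Action

end FLRam

end

/-! Write `ũ` for the uniformiser of `K`. Of the condition defining `ramGroup`, only the case `E =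
K` is needed. There the Herbrand function is the identity, so `v > (a + 1) p ^ (N - 1) - 1` gives `τ
ũ = ũ + ũ ^ ((a + 1) p ^ (N - 1)) w` with `w` in `m_sep`. Comparing the action on `b` times the
uniformiser for `b` in the perfect field `k`, and extracting `p ^ n`-th roots, shows that `τ` also
fixes `k`.

Modulo `p ^ N` the value of `[p ^ (N - 1)]` depends only on the first Witt coordinate
(`lubinTateP_iterate_eq`), and `u_1` has first coordinate `ũ ^ (p ^ (N - 1))`. Hence `τ u_1 = u_1 (1
+ u_1 ^ a z)` with `z` in `W_N(m_sep)` (`exists_wittAct_uElt_one_eq`). Applying `σ` gives `τ u_0 =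
u_0 (1 + u_0 ^ a σ z)`, which is the first claim. Dividing, `τ t = t c` with `c = (1 + u_0 ^ a σ z)
/ (1 + u_1 ^ a z)`. Since `u_0` divides `σ u_0`, one gets `σ c ≡ 1` modulo `u_0 ^ a O_N^+`, and this
is the second claim.

For the third claim the difficulty is that `W_N(τ)` need not preserve `O_N(Ksep)`: the image of
`u_N` is the Teichmüller element of `τ ũ`. It does map the smaller ring `W_N(σ ^ (N - 1) Ksep)[u_1]`
into `O_N(Ksep)` (`wittAct_mem_liftRing`), because `O_N(Ksep)` lifts `Ksep`, the uniformiser being a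
`p`-basis. Every value of a morphism `ξ` has a representative in this smaller ring
(`exists_saMk_eq_of_mem_frobRing`): `M` is generated by the images of the `φ_i`, and each `φ_i` is
`σ` after division by `t ^ i`, so the relation `ξ φ_i = φ_i ξ` can be used `N - 1` times to gain
powers of `σ`. The first two claims then make `τ ξ` well defined and compatible with all `φ_i`; the
laws of an action follow from uniqueness of the transported value. -/

namespace FLRam

/-! ### The uniformiser as a `p`-basis of `Ksep`. -/

section PBasis

theorem _root_.PowerSeries.map_frobenius_expand {R : Type*} [CommRing R] (p : ℕ) [ExpChar R p]
    (hp : p ≠ 0) (f : PowerSeries R) :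
    (f.expand p hp).map (frobenius R p) = f ^ p :=
  MvPowerSeries.map_frobenius_expand p hp

/-- Over a perfect ring of characteristic `p`, the powers `X ^ i` with `i < p` generate the power
series as a module over the `p`-th powers. -/
theorem _root_.PowerSeries.exists_eq_sum_X_pow_mul_pow {R : Type*} [CommRing R] (p : ℕ)
    [Fact p.Prime] [CharP R p] [PerfectRing R p] (f : PowerSeries R) :
    ∃ g : ℕ → PowerSeries R, f = ∑ i ∈ Finset.range p, PowerSeries.X ^ i * g i ^ p := by
  have hp : 0 < p := (Fact.out : p.Prime).pos
  refine ⟨fun i => PowerSeries.mk fun n => (frobeniusEquiv R p).symm (f.coeff (p * n + i)), ?_⟩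
  ext n
  have key : ∀ i ∈ Finset.range p, PowerSeries.coeff n (PowerSeries.X ^ i *
      (PowerSeries.mk fun n => (frobeniusEquiv R p).symm (f.coeff (p * n + i))) ^ p) =
      if i = n % p then f.coeff n else 0 := by
    intro i hi
    have hip := Finset.mem_range.1 hi
    rw [← PowerSeries.map_frobenius_expand p hp.ne', PowerSeries.coeff_X_pow_mul']
    by_cases hin : i ≤ n
    · rw [if_pos hin, PowerSeries.coeff_map, PowerSeries.coeff_expand]
      by_cases hd : p ∣ n - i
      · obtain ⟨q, hq⟩ := hd
        have hn : n = p * q + i := by omega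
        have hmod : i = n % p := by rw [hn, Nat.mul_add_mod, Nat.mod_eq_of_lt hip]
        rw [if_pos ⟨q, hq⟩, if_pos hmod, hq, Nat.mul_div_cancel_left _ hp, PowerSeries.coeff_mk,
          frobenius_apply_frobeniusEquiv_symm, ← hn]
      · rw [if_neg hd, if_neg, map_zero]
        rintro rfl
        exact hd (Nat.dvd_sub_mod n)
    · rw [if_neg hin, if_neg]
      rintro rfl
      exact hin (Nat.mod_le n p)
  rw [map_sum, Finset.sum_congr rfl key, Finset.sum_ite_eq', if_pos]
  exact Finset.mem_range.2 (Nat.mod_lt n hp)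

variable (p : ℕ) [Fact p.Prime] (k : Type*) [Field k] [CharP k p]

theorem _root_.LaurentSeries.exists_eq_sum_X_pow_mul_pow [PerfectRing k p] (f : k⸨X⸩) :
    ∃ g : ℕ → k⸨X⸩, f = ∑ i ∈ Finset.range p, HahnSeries.single 1 1 ^ i * g i ^ p := by
  have hp : 1 ≤ p := (Fact.out : p.Prime).one_le
  -- The pole is cleared by a power of the uniformiser with exponent divisible by `p`; such a factor
  -- can be absorbed into the `p`-th powers `g i ^ p`.
  obtain ⟨m, hm⟩ : ∃ m : ℕ, 0 ≤ f.order + p * m := by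
    refine ⟨f.order.natAbs, ?_⟩
    have : (1 : ℤ) ≤ p := by exact_mod_cast hp
    nlinarith [abs_nonneg f.order, neg_abs_le f.order, Int.natCast_natAbs f.order]
  obtain ⟨e, he⟩ := Int.eq_ofNat_of_zero_le hm
  obtain ⟨g, hg⟩ := PowerSeries.exists_eq_sum_X_pow_mul_pow p
    (PowerSeries.X ^ e * f.powerSeriesPart)
  let x : k⸨X⸩ := HahnSeries.single 1 1
  have hx : x ≠ 0 := by simp [x]
  have hf : f = x⁻¹ ^ (p * m) * (HahnSeries.ofPowerSeries ℤ k
      (PowerSeries.X ^ e * f.powerSeriesPart)) := by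
    have h1 : x⁻¹ ^ (p * m) = HahnSeries.single (-(p * m : ℤ)) 1 := by
      rw [show x⁻¹ = HahnSeries.single (-1) 1 by simp [x], HahnSeries.single_pow]
      simp
    rw [map_mul, HahnSeries.ofPowerSeries_X_pow, ← mul_assoc, h1, HahnSeries.single_mul_single,
      one_mul, show -(p * m : ℤ) + (e : ℤ) = f.order by
        have : (e : ℤ) = f.order + p * m := he.symm
        rw [this]; ring]
    exact f.single_order_mul_powerSeriesPart.symm
  refine ⟨fun i => x⁻¹ ^ m * HahnSeries.ofPowerSeries ℤ k (g i), ?_⟩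
  rw [hg, map_sum, Finset.mul_sum] at hf
  refine hf.trans (Finset.sum_congr rfl fun i _ => ?_)
  rw [map_mul, map_pow, map_pow, HahnSeries.ofPowerSeries_X, mul_pow, ← pow_mul, mul_comm m p]
  ring

variable (Ksep : Type*) [Field Ksep] [Algebra k⸨X⸩ Ksep]

/-- The uniformiser of `K`, regarded as an element of `Ksep`. -/
noncomputable def unif : Ksep := algebraMap k⸨X⸩ Ksep (HahnSeries.single 1 1)

theorem unif_ne_zero : unif k Ksep ≠ 0 := by simp [unif]

variable [PerfectRing k p] [IsSepClosure k⸨X⸩ Ksep]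

/-- The uniformiser of `K` is a `p`-basis of `Ksep`. -/
theorem exists_eq_sum_unif_pow_mul_pow (x : Ksep) :
    ∃ g : ℕ → Ksep, x = ∑ i ∈ Finset.range p, unif k Ksep ^ i * g i ^ p := by
  have := charP_sep p k Ksep
  have : CharP k⸨X⸩ p := charP_of_injective_ringHom (HahnSeries.C (Γ := ℤ) (R := k)).injective p
  have : Algebra.IsSeparable k⸨X⸩ Ksep := IsSepClosure.separable
  -- Separability enters here: `Ksep` is spanned over `K` by its `p`-th powers, which reduces the
  -- claim to the known decomposition of `K` itself.
  have hspan : x ∈ Submodule.span k⸨X⸩ (Set.range fun y : Ksep => y ^ p ^ 1) := by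
    rw [Field.span_map_pow_expChar_pow_eq_top_of_isSeparable (v := fun y : Ksep => y) p 1
      (by rw [show (Set.range fun y : Ksep => y) = Set.univ from Set.range_id]
          exact Submodule.span_univ)]
    trivial
  have hadd : ∀ g h : ℕ → Ksep, ∑ i ∈ Finset.range p, unif k Ksep ^ i * g i ^ p +
      ∑ i ∈ Finset.range p, unif k Ksep ^ i * h i ^ p =
      ∑ i ∈ Finset.range p, unif k Ksep ^ i * (g i + h i) ^ p := by
    intro g h
    rw [← Finset.sum_add_distrib]
    refine Finset.sum_congr rfl fun i _ => ?_
    rw [add_pow_char, mul_add]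
  induction hspan using Submodule.span_induction with
  | mem x hx =>
    obtain ⟨y, rfl⟩ := hx
    have hp : 0 ∈ Finset.range p := Finset.mem_range.2 (Fact.out : p.Prime).pos
    have hp0 : p ≠ 0 := (Fact.out : p.Prime).ne_zero
    refine ⟨fun i => if i = 0 then y else 0, ?_⟩
    rw [Finset.sum_eq_single_of_mem 0 hp (fun i _ hi => by simp [hi, hp0])]
    simp
  | zero => exact ⟨0, by simp [(Fact.out : p.Prime).ne_zero]⟩
  | add x y _ _ hx hy =>
    obtain ⟨g, hg⟩ := hx
    obtain ⟨h, hh⟩ := hy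
    exact ⟨fun i => g i + h i, by rw [← hadd, ← hg, ← hh]⟩
  | smul c x _ hx =>
    obtain ⟨g, hg⟩ := hx
    obtain ⟨d, hd⟩ := LaurentSeries.exists_eq_sum_X_pow_mul_pow p k c
    have hsum : ∀ s : Finset ℕ, ∀ y : ℕ → Ksep,
        (∀ j ∈ s, ∃ h : ℕ → Ksep, y j = ∑ i ∈ Finset.range p, unif k Ksep ^ i * h i ^ p) →
        ∃ h : ℕ → Ksep, ∑ j ∈ s, y j = ∑ i ∈ Finset.range p, unif k Ksep ^ i * h i ^ p := by
      intro s y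
      induction s using Finset.induction_on with
      | empty => exact fun _ => ⟨0, by simp [(Fact.out : p.Prime).ne_zero]⟩
      | insert j s hj ih =>
        intro h
        obtain ⟨h1, hh1⟩ := h j (Finset.mem_insert_self _ _)
        obtain ⟨h2, hh2⟩ := ih fun i hi => h i (Finset.mem_insert_of_mem hi)
        exact ⟨fun i => h1 i + h2 i, by rw [Finset.sum_insert hj, hh1, hh2, hadd]⟩
    have hp : 0 < p := (Fact.out : p.Prime).pos
    have hmon : ∀ (e : ℕ) (y : Ksep), ∃ h : ℕ → Ksep,
        unif k Ksep ^ e * y ^ p = ∑ i ∈ Finset.range p, unif k Ksep ^ i * h i ^ p := by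
      intro e y
      refine ⟨fun i => if i = e % p then unif k Ksep ^ (e / p) * y else 0, ?_⟩
      rw [Finset.sum_eq_single_of_mem (e % p) (Finset.mem_range.2 (Nat.mod_lt e hp))
        (fun i _ hi => by simp [hi, hp.ne'])]
      dsimp only
      rw [if_pos rfl, mul_pow, ← mul_assoc, ← pow_mul, ← pow_add, mul_comm (e / p),
        Nat.mod_add_div]
    rw [Algebra.smul_def, hg, hd, map_sum, Finset.sum_mul_sum]
    refine hsum _ _ fun i _ => hsum _ _ fun j _ => ?_
    obtain ⟨h, hh⟩ := hmon (i + j) (algebraMap k⸨X⸩ Ksep (d i) * g j)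
    refine ⟨h, ?_⟩
    rw [← hh, map_mul, map_pow, map_pow, unif]
    ring

/-- `Ksep` is generated as a ring by its `p ^ n`-th powers and the uniformiser of `K`. -/
theorem mem_closure_pow_unif (n : ℕ) (x : Ksep) :
    x ∈ Subring.closure (insert (unif k Ksep) (Set.range fun y : Ksep => y ^ p ^ n)) := by
  have := charP_sep p k Ksep
  induction n generalizing x with
  | zero => exact Subring.subset_closure (Set.mem_insert_of_mem _ ⟨x, by simp⟩)
  | succ n ih =>
    obtain ⟨g, rfl⟩ := exists_eq_sum_unif_pow_mul_pow p k Ksep x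
    have hu := Subring.subset_closure (R := Ksep)
      (Set.mem_insert (unif k Ksep) (Set.range fun y : Ksep => y ^ p ^ (n + 1)))
    refine sum_mem fun i _ => mul_mem (pow_mem hu i) ?_
    -- Frobenius carries the ring for `n` into the ring for `n + 1`, so the coefficients `g i ^ p`
    -- of the `p`-basis expansion already lie in the latter.
    have hle : Subring.closure (insert (unif k Ksep) (Set.range fun y : Ksep => y ^ p ^ n)) ≤
        (Subring.closure (insert (unif k Ksep)
          (Set.range fun y : Ksep => y ^ p ^ (n + 1)))).comap (frobenius Ksep p) := by
      refine Subring.closure_le.2 ?_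
      rintro y (rfl | ⟨z, rfl⟩)
      · exact pow_mem hu p
      · refine Subring.subset_closure (Set.mem_insert_of_mem _ ⟨z, ?_⟩)
        change z ^ p ^ (n + 1) = (z ^ p ^ n) ^ p
        rw [← pow_mul, pow_succ]
    exact hle (ih (g i))

end PBasis

/-! ### What the ramification condition at `E = K` says. -/

section Ramification

variable (k : Type*) [Field k] (Ksep : Type*) [Field Ksep] [Algebra k⸨X⸩ Ksep]

theorem sepNorm_unif : sepNorm k (unif k Ksep) = 2⁻¹ := by
  rw [unif, sepNorm_algebraMap_of_ne_zero k (by simp), HahnSeries.order_single one_ne_zero]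
  norm_num

theorem sepNorm_constHom {c : k} (hc : c ≠ 0) : sepNorm k (constHom k Ksep c) = 1 := by
  rw [constHom, RingHom.comp_apply, sepNorm_algebraMap_of_ne_zero k (by simpa using hc),
    HahnSeries.C_apply, HahnSeries.order_single hc]
  simp

variable [IsSepClosure k⸨X⸩ Ksep]

theorem sepNorm_eq_zero {x : Ksep} : sepNorm k x = 0 ↔ x = 0 := by
  refine ⟨fun h => by_contra fun hx => ?_, fun h => h ▸ sepNorm_zero k⟩
  have h1 := sepNorm_mul k x x⁻¹
  rw [mul_inv_cancel₀ hx, sepNorm_one, h, zero_mul] at h1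
  exact one_ne_zero h1

theorem sepNorm_inv (x : Ksep) : sepNorm k x⁻¹ = (sepNorm k x)⁻¹ := by
  rcases eq_or_ne x 0 with rfl | hx
  · simp [sepNorm_zero]
  · have h1 := sepNorm_mul k x x⁻¹
    rw [mul_inv_cancel₀ hx, sepNorm_one] at h1
    exact eq_inv_of_mul_eq_one_right h1.symm

theorem unifNorm_bot : unifNorm k (⊥ : IntermediateField k⸨X⸩ Ksep) = 2⁻¹ := by
  refine IsGreatest.csSup_eq ⟨⟨unif k Ksep, IntermediateField.algebraMap_mem _ _, ?_, ?_⟩, ?_⟩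
  · rw [sepNorm_unif]; norm_num
  · exact sepNorm_unif k Ksep
  · rintro r ⟨x, hx, hx1, rfl⟩
    obtain ⟨f, rfl⟩ := IntermediateField.mem_bot.1 hx
    rcases eq_or_ne f 0 with rfl | hf
    · rw [map_zero, sepNorm_zero]; norm_num
    · rw [sepNorm_algebraMap_of_ne_zero k hf] at hx1 ⊢
      have h0 : -f.order < 0 := (zpow_lt_one_iff_right₀ one_lt_two).1 hx1
      calc (2 : ℝ) ^ (-f.order) ≤ 2 ^ (-1 : ℤ) :=
            zpow_le_zpow_right₀ one_le_two (by omega)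
        _ = 2⁻¹ := by norm_num

theorem relIndex_bot (x : ℝ) : relIndex k (⊥ : IntermediateField k⸨X⸩ Ksep) x = 1 := by
  have hval : ∀ (ι : (⊥ : IntermediateField k⸨X⸩ Ksep) →ₐ[k⸨X⸩] Ksep)
      (y : (⊥ : IntermediateField k⸨X⸩ Ksep)), ι y = y := by
    intro ι y
    obtain ⟨f, hf⟩ := IntermediateField.mem_bot.1 y.2
    have : y = algebraMap k⸨X⸩ _ f := Subtype.ext hf.symm
    rw [this, AlgHom.commutes]
    rfl
  have : Subsingleton (RelEmb k (⊥ : IntermediateField k⸨X⸩ Ksep)) :=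
    ⟨fun ι₁ ι₂ => Subtype.ext (AlgHom.ext fun y => by rw [hval, hval])⟩
  have : Nonempty (RelEmb k (⊥ : IntermediateField k⸨X⸩ Ksep)) :=
    ⟨⟨IntermediateField.val _, fun y _ => by
      rw [hval, sub_self, sepNorm_zero]; exact one_pos⟩⟩
  rw [relIndex, Nat.card_eq_one_iff_unique]
  exact ⟨inferInstance, Nonempty.map (Quotient.mk _) inferInstance⟩

theorem herbrand_bot (x : ℝ) : herbrand k (⊥ : IntermediateField k⸨X⸩ Ksep) x = x := by
  simp [herbrand, relIndex_bot]

variable {k Ksep}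

/-- The defining condition for the trivial extension, where the Herbrand function is the identity
and the uniformiser has norm `1 / 2`. -/
theorem sepNorm_sub_le_of_mem_ramGroup {v : ℝ} (hv : 0 ≤ v) {τ : RingAut Ksep}
    (hτ : τ ∈ ramGroup k Ksep v) (f : k⸨X⸩) (hf : sepNorm k (algebraMap k⸨X⸩ Ksep f) < 1) :
    sepNorm k (τ (algebraMap k⸨X⸩ Ksep f) - algebraMap k⸨X⸩ Ksep f) ≤ 2⁻¹ ^ (1 + v) := by
  have h := hτ.2 ⊥ inferInstance v hv (herbrand_bot k Ksep v) (algebraMap k⸨X⸩ Ksep f)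
    (IntermediateField.algebraMap_mem _ _) hf
  rwa [unifNorm_bot] at h

/-- Elements of `I_K^(v)` with `v > 0` fix the perfect field of coefficients. -/
theorem apply_constHom_of_mem_ramGroup (p : ℕ) [Fact p.Prime] [CharP k p] [PerfectRing k p]
    {v : ℝ} (hv : 0 < v) {τ : RingAut Ksep} (hτ : τ ∈ ramGroup k Ksep v) (c : k) :
    τ (constHom k Ksep c) = constHom k Ksep c := by
  have := charP_sep p k Ksep
  have hu := sepNorm_unif k Ksep
  -- The condition only concerns elements of the maximal ideal, so it is applied to `ũ` and `b ũ`;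
  -- eliminating `ũ` costs one factor `1 / 2`.
  have hbound : ∀ b : k, sepNorm k (τ (constHom k Ksep b) - constHom k Ksep b) ≤ 2⁻¹ ^ v := by
    intro b
    rcases eq_or_ne b 0 with rfl | hb
    · rw [map_zero, map_zero, sub_zero, sepNorm_zero]; positivity
    have e1 := sepNorm_sub_le_of_mem_ramGroup hv.le hτ (HahnSeries.single 1 1)
      (by rw [← unif, hu]; norm_num)
    have e2 := sepNorm_sub_le_of_mem_ramGroup hv.le hτ (HahnSeries.C b * HahnSeries.single 1 1)
      (by rw [map_mul, sepNorm_mul, ← unif, hu]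
          change sepNorm k (constHom k Ksep b) * _ < 1
          rw [sepNorm_constHom k Ksep hb]; norm_num)
    rw [map_mul] at e2
    change sepNorm k (τ (constHom k Ksep b * unif k Ksep) - constHom k Ksep b * unif k Ksep) ≤ _
      at e2
    change sepNorm k (τ (unif k Ksep) - unif k Ksep) ≤ _ at e1
    have e3 : (τ (constHom k Ksep b) - constHom k Ksep b) * τ (unif k Ksep) =
        (τ (constHom k Ksep b * unif k Ksep) - constHom k Ksep b * unif k Ksep) -
        constHom k Ksep b * (τ (unif k Ksep) - unif k Ksep) := by
      rw [map_mul]; ring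
    have e4 : sepNorm k (τ (constHom k Ksep b) - constHom k Ksep b) * 2⁻¹ ≤ 2⁻¹ ^ (1 + v) := by
      have e5 : sepNorm k (τ (unif k Ksep)) = 2⁻¹ := by rw [hτ.1.1, hu]
      rw [← e5, ← sepNorm_mul, e3, e5]
      refine (sepNorm_sub_le k _ _).trans (max_le e2 ?_)
      rw [sepNorm_mul, sepNorm_constHom k Ksep hb, one_mul]
      exact e1
    rw [Real.rpow_add (by norm_num), Real.rpow_one, mul_comm] at e4
    exact le_of_mul_le_mul_left e4 (by norm_num)
  have hlt : (2⁻¹ : ℝ) ^ v < 1 := Real.rpow_lt_one (by norm_num) (by norm_num) hv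
  -- With `c = b ^ (p ^ n)`, additivity of Frobenius raises the bound for `b` to the power `p ^ n`,
  -- which is more than the power `n` kept here.
  have hn : ∀ n : ℕ, sepNorm k (τ (constHom k Ksep c) - constHom k Ksep c) ≤
      ((2⁻¹ : ℝ) ^ v) ^ n := by
    intro n
    obtain ⟨b, rfl⟩ : ∃ b, b ^ p ^ n = c :=
      ⟨(iterateFrobeniusEquiv k p n).symm c, by
        rw [← iterateFrobenius_def]; exact (iterateFrobeniusEquiv k p n).apply_symm_apply c⟩
    rw [map_pow, map_pow, ← sub_pow_char_pow, sepNorm_pow]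
    exact (pow_le_pow_left₀ (sepNorm_nonneg k _) (hbound b) _).trans
      (pow_le_pow_of_le_one (by positivity) hlt.le
        (Nat.lt_pow_self (Fact.out : p.Prime).one_lt).le)
  have h0 : sepNorm k (τ (constHom k Ksep c) - constHom k Ksep c) ≤ 0 :=
    ge_of_tendsto' (tendsto_pow_atTop_nhds_zero_of_lt_one (by positivity) hlt) hn
  exact sub_eq_zero.1 ((sepNorm_eq_zero k Ksep).1 (h0.antisymm (sepNorm_nonneg k _)))

/-- Strictness of `e < 1 + v` is what puts `w` in the maximal ideal and not merely in the valuation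
ring. -/
theorem exists_apply_unif_eq_of_mem_ramGroup {v : ℝ} (hv : 0 ≤ v) {τ : RingAut Ksep}
    (hτ : τ ∈ ramGroup k Ksep v) {e : ℕ} (he : (e : ℝ) < 1 + v) :
    ∃ w : Ksep, sepNorm k w < 1 ∧ τ (unif k Ksep) = unif k Ksep + unif k Ksep ^ e * w := by
  have hu := sepNorm_unif k Ksep
  have hu0 := unif_ne_zero k Ksep
  refine ⟨(unif k Ksep ^ e)⁻¹ * (τ (unif k Ksep) - unif k Ksep), ?_, ?_⟩
  · have h1 := sepNorm_sub_le_of_mem_ramGroup hv hτ (HahnSeries.single 1 1)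
      (by rw [← unif, hu]; norm_num)
    rw [← unif] at h1
    rw [sepNorm_mul, sepNorm_inv, sepNorm_pow, hu, inv_mul_lt_one₀ (by positivity)]
    refine h1.trans_lt ?_
    rw [← Real.rpow_natCast]
    exact Real.rpow_lt_rpow_of_exponent_gt (by norm_num) (by norm_num) he
  · field_simp
    ring

end Ramification

/-! ### Frobenius, iterates of `[p]`, and truncated Witt vectors. -/

theorem frobenius_eq_shift_mul (p : ℕ) [Fact p.Prime] {R : Type*} [CommRing R] [CharP R p]
    {x : WittVector p R} (hx : x.coeff 0 = 0) :
    WittVector.frobenius x = x.shift 1 * p := by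
  have h : x = WittVector.verschiebung (x.shift 1) := by
    simpa using WittVector.eq_iterate_verschiebung (x := x) (n := 1) (by simpa using hx)
  conv_lhs => rw [h]
  exact WittVector.frobenius_verschiebung _

theorem sub_dvd_lubinTateP_iterate_sub (p : ℕ) {R : Type*} [CommRing R] (n : ℕ) (x y : R) :
    x - y ∣ (lubinTateP p)^[n] x - (lubinTateP p)^[n] y := by
  induction n with
  | zero => exact dvd_rfl
  | succ n ih =>
    rw [Function.iterate_succ_apply', Function.iterate_succ_apply']
    refine ih.trans ?_
    rw [lubinTateP, lubinTateP, add_sub_add_comm, ← mul_sub]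
    exact dvd_add (Dvd.intro_left _ rfl) (sub_dvd_pow_sub_pow _ _ _)

section Truncated

variable (p : ℕ) [Fact p.Prime] {N : ℕ} (hN : 1 ≤ N) (R : Type*) [CommRing R]

/-- The projection `W_N(R) → R` to the first coordinate. -/
noncomputable def coeffZero : TruncatedWittVector p N R →+* R :=
  RingHom.liftOfSurjective (WittVector.truncate N) (WittVector.truncate_surjective p N R)
    ⟨WittVector.constantCoeff, by
      intro x hx
      rw [WittVector.mem_ker_truncate] at hx
      exact hx 0 hN⟩

theorem coeffZero_truncate (x : WittVector p R) :
    coeffZero p hN R (WittVector.truncate N x) = x.coeff 0 :=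
  RingHom.liftOfRightInverse_comp_apply _ _ _ _ x

theorem coeffZero_eq (x : TruncatedWittVector p N R) : coeffZero p hN R x = x.coeff ⟨0, hN⟩ := by
  obtain ⟨y, rfl⟩ := WittVector.truncate_surjective p N R x
  rw [coeffZero_truncate, WittVector.coeff_truncate]

variable (N) {R}

/-- The Teichmüller representative in `W_N(R)`. -/
noncomputable def teich : R →* TruncatedWittVector p N R :=
  (WittVector.truncate N : WittVector p R →+* _).toMonoidHom.comp (WittVector.teichmuller p)

theorem teich_apply (x : R) :
    teich p N x = WittVector.truncate N (WittVector.teichmuller p x) := rfl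

theorem coeffZero_teich (x : R) : coeffZero p hN R (teich p N x) = x := by
  rw [teich_apply, coeffZero_truncate, WittVector.teichmuller_coeff_zero]

theorem twMap_teich {S : Type*} [CommRing S] (f : R →+* S) (x : R) :
    twMap p N f (teich p N x) = teich p N (f x) := by
  rw [teich_apply, twMap_truncate, WittVector.map_teichmuller, teich_apply]

theorem twMap_twMap {S T : Type*} [CommRing S] [CommRing T] (g : S →+* T) (f : R →+* S)
    (x : TruncatedWittVector p N R) : twMap p N g (twMap p N f x) = twMap p N (g.comp f) x := by
  ext i
  rw [coeff_twMap, coeff_twMap, coeff_twMap, RingHom.comp_apply]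

end Truncated

/-! ### Inverses, lifts and automorphisms in `W_N(Ksep)`. -/

section Lift

variable (p : ℕ) [Fact p.Prime] (k : Type*) [Field k] [CharP k p]
  (Ksep : Type*) [Field Ksep] [Algebra k⸨X⸩ Ksep] [IsSepClosure k⸨X⸩ Ksep] {N : ℕ} (hN : 1 ≤ N)

theorem sigma_injective : Function.Injective (sigma p k Ksep N) := by
  intro x y h
  ext i
  have := congrArg (TruncatedWittVector.coeff i) h
  rw [sigma, coeff_twMap, coeff_twMap] at this
  exact (frobSep p k Ksep).injective this

theorem sigma_twMap_frobSep_pow (n : ℕ) (x : TruncatedWittVector p N Ksep) :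
    sigma p k Ksep N (twMap p N (frobSep p k Ksep ^ n) x) =
      twMap p N (frobSep p k Ksep ^ (n + 1)) x := by
  rw [sigma, twMap_twMap, pow_succ', RingHom.mul_def]

/-- The Frobenius maps the kernel of `W_N(Ksep) → Ksep` to `p W_N(Ksep)`. -/
theorem natCast_dvd_sigma {x : TruncatedWittVector p N Ksep} (hx : coeffZero p hN Ksep x = 0) :
    (p : TruncatedWittVector p N Ksep) ∣ sigma p k Ksep N x := by
  have := charP_sep p k Ksep
  obtain ⟨y, rfl⟩ := WittVector.truncate_surjective p N Ksep x
  rw [coeffZero_truncate] at hx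
  refine ⟨WittVector.truncate N (y.shift 1), ?_⟩
  have h := congrArg (WittVector.truncate N) (frobenius_eq_shift_mul p hx)
  rw [WittVector.frobenius_eq_map_frobenius, map_mul, map_natCast, mul_comm] at h
  rw [← h, sigma, twMap_truncate]
  rfl

include k in
/-- The value of `[p ^ (N - 1)]` modulo `p ^ N` depends only on the first coordinate. -/
theorem lubinTateP_iterate_eq {x y : TruncatedWittVector p N Ksep}
    (h : coeffZero p hN Ksep x = coeffZero p hN Ksep y) :
    (lubinTateP p)^[N - 1] x = (lubinTateP p)^[N - 1] y := by
  have := charP_sep p k Ksep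
  -- As `Ksep` is not perfect, equal first coordinates do not give a congruence modulo `p`; they do
  -- after `σ`, because `σ V = p`. Each step of the iteration then gains a factor `p`, and `p ^ N =
  -- 0`.
  apply sigma_injective p k Ksep
  rw [map_lubinTateP_iterate, map_lubinTateP_iterate, ← sub_eq_zero]
  have h1 := lubinTateP_iterate_congr p (x := sigma p k Ksep N x) (y := sigma p k Ksep N y)
    (by rw [← map_sub]
        exact natCast_dvd_sigma p k Ksep hN (by rw [map_sub, h, sub_self])) (N - 1)
  rw [Nat.sub_add_cancel hN, natCast_pow_eq_zero p N Ksep] at h1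
  exact zero_dvd_iff.1 h1

include k in
-- Same mechanism as for iterates of `[p]`: after `σ` both bases agree modulo `p`, hence their `p ^
-- (N - 1)`-th powers agree modulo `p ^ N = 0`.
theorem pow_eq_teich_pow (x : TruncatedWittVector p N Ksep) :
    x ^ p ^ (N - 1) = teich p N (coeffZero p hN Ksep x) ^ p ^ (N - 1) := by
  have := charP_sep p k Ksep
  apply sigma_injective p k Ksep
  rw [map_pow, map_pow, ← sub_eq_zero]
  have h1 := dvd_sub_pow_of_dvd_sub (p := p)
    (a := sigma p k Ksep N x) (b := sigma p k Ksep N (teich p N (coeffZero p hN Ksep x)))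
    (by rw [← map_sub]
        exact natCast_dvd_sigma p k Ksep hN
          (by rw [map_sub, coeffZero_teich, sub_self])) (N - 1)
  rw [Nat.sub_add_cancel hN, natCast_pow_eq_zero p N Ksep] at h1
  exact zero_dvd_iff.1 h1

include k in
theorem mul_pow_mul_teich_inv {x : TruncatedWittVector p N Ksep}
    (hx : coeffZero p hN Ksep x ≠ 0) :
    x * (x ^ (p ^ (N - 1) - 1) * teich p N (coeffZero p hN Ksep x)⁻¹ ^ p ^ (N - 1)) = 1 := by
  have hp : p ^ (N - 1) ≠ 0 := pow_ne_zero _ (Fact.out : p.Prime).ne_zero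
  rw [← mul_assoc, mul_pow_sub_one hp, pow_eq_teich_pow p k Ksep hN, ← mul_pow, ← map_mul,
    mul_inv_cancel₀ hx, map_one, one_pow]

include k in
-- The inverse is `x ^ (p ^ (N - 1) - 1)` times a `p ^ (N - 1)`-th power of a Teichmüller element.
-- That power lies in every subring containing `W_N(σ ^ (N - 1) Ksep)`, so all such subrings are
-- closed under inverting their elements.
theorem mem_of_mul_eq_one {S : Subring (TruncatedWittVector p N Ksep)}
    {x y : TruncatedWittVector p N Ksep} (hx : x ∈ S) (hxy : x * y = 1)
    (hS : teich p N (coeffZero p hN Ksep x)⁻¹ ^ p ^ (N - 1) ∈ S) : y ∈ S := by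
  have h0 : coeffZero p hN Ksep x ≠ 0 := by
    intro h
    have := congrArg (coeffZero p hN Ksep) hxy
    rw [map_mul, h, zero_mul, map_one] at this
    exact zero_ne_one this
  have h1 := mul_pow_mul_teich_inv p k Ksep hN h0
  have : y = x ^ (p ^ (N - 1) - 1) * teich p N (coeffZero p hN Ksep x)⁻¹ ^ p ^ (N - 1) :=
    (IsUnit.of_mul_eq_one _ hxy).mul_left_cancel (hxy.trans h1.symm)
  rw [this]
  exact mul_mem (pow_mem hx _) hS

theorem teich_pow_eq_twMap (n : ℕ) (x : Ksep) :
    teich p N x ^ p ^ n = twMap p N (frobSep p k Ksep ^ n) (teich p N x) := by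
  rw [twMap_teich, frobSep_pow_apply, map_pow]

variable (N) in
/-- The subring `W_N(σ ^ n Ksep)[u_1]` of `W_N(Ksep)`. -/
noncomputable def frobRing (n : ℕ) : Subring (TruncatedWittVector p N Ksep) :=
  Subring.closure (insert (uElt p k Ksep N 1) (Set.range (twMap p N (frobSep p k Ksep ^ n))))

theorem uElt_one_mem_frobRing (n : ℕ) : uElt p k Ksep N 1 ∈ frobRing p k Ksep N n :=
  Subring.subset_closure (Set.mem_insert _ _)

theorem twMap_mem_frobRing (n : ℕ) (x : TruncatedWittVector p N Ksep) :
    twMap p N (frobSep p k Ksep ^ n) x ∈ frobRing p k Ksep N n :=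
  Subring.subset_closure (Set.mem_insert_of_mem _ ⟨x, rfl⟩)

theorem twMap_mem_liftRing (x : TruncatedWittVector p N Ksep) :
    twMap p N (frobSep p k Ksep ^ (N - 1)) x ∈ liftRing p k Ksep N :=
  Subring.subset_closure (Set.mem_insert_of_mem _ ⟨x, rfl⟩)

theorem teich_pow_mem_frobRing {n : ℕ} (hn : n ≤ N - 1) (x : Ksep) :
    teich p N x ^ p ^ (N - 1) ∈ frobRing p k Ksep N n := by
  obtain ⟨j, hj⟩ := Nat.exists_eq_add_of_le hn
  rw [hj, pow_add, pow_mul, teich_pow_eq_twMap p k Ksep n]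
  exact pow_mem (twMap_mem_frobRing p k Ksep n _) _

theorem teich_pow_mem_liftRing (x : Ksep) :
    teich p N x ^ p ^ (N - 1) ∈ liftRing p k Ksep N := by
  rw [teich_pow_eq_twMap p k Ksep]
  exact twMap_mem_liftRing p k Ksep _

include hN in
theorem uElt_zero_eq : uElt p k Ksep N 0 = lubinTateP p (uElt p k Ksep N 1) := by
  obtain ⟨n, rfl⟩ : ∃ n, N = n + 1 := ⟨N - 1, by omega⟩
  rw [uElt, uElt, Nat.sub_zero, Nat.add_sub_cancel, Function.iterate_succ_apply']

theorem lubinTateP_mem {R : Type*} [CommRing R] {S : Subring R} {x : R} (hx : x ∈ S) :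
    lubinTateP p x ∈ S :=
  add_mem (mul_mem (natCast_mem _ p) hx) (pow_mem hx p)

include hN in
-- This is the gain of one power of Frobenius. The generator `u_1` causes no loss, since `σ u_1 =
-- u_0 = [p](u_1)`.
theorem sigma_mem_frobRing {n : ℕ} {x : TruncatedWittVector p N Ksep}
    (hx : x ∈ frobRing p k Ksep N n) : sigma p k Ksep N x ∈ frobRing p k Ksep N (n + 1) := by
  suffices h : frobRing p k Ksep N n ≤
    (frobRing p k Ksep N (n + 1)).comap (sigma p k Ksep N) from h hx
  refine Subring.closure_le.2 ?_
  rintro y (rfl | ⟨z, rfl⟩)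
  · change sigma p k Ksep N (uElt p k Ksep N 1) ∈ frobRing p k Ksep N (n + 1)
    rw [sigma_uElt_one p k Ksep hN, uElt_zero_eq p k Ksep hN]
    exact lubinTateP_mem p (uElt_one_mem_frobRing p k Ksep _)
  · change sigma p k Ksep N (twMap p N (frobSep p k Ksep ^ n) z) ∈ frobRing p k Ksep N (n + 1)
    rw [sigma_twMap_frobSep_pow]
    exact twMap_mem_frobRing p k Ksep _ z

theorem tElt_mem_frobRing (n : ℕ) : tElt p k Ksep N ∈ frobRing p k Ksep N n :=
  add_mem (natCast_mem _ p) (pow_mem (uElt_one_mem_frobRing p k Ksep n) _)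

theorem coeffZero_uElt (m : ℕ) :
    coeffZero p hN Ksep (uElt p k Ksep N m) = unif k Ksep ^ p ^ (N - m) := by
  have := charP_sep p k Ksep
  rw [uElt, map_lubinTateP_iterate, uTop]
  change (lubinTateP p)^[N - m] (coeffZero p hN Ksep (teich p N (unif k Ksep))) = _
  rw [coeffZero_teich]
  induction N - m with
  | zero => simp
  | succ n ih =>
    rw [Function.iterate_succ_apply', ih, lubinTateP, CharP.cast_eq_zero, zero_mul, zero_add,
      ← pow_mul, pow_succ]

include hN in
theorem isUnit_uElt (m : ℕ) : IsUnit (uElt p k Ksep N m) := by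
  refine IsUnit.of_mul_eq_one _ (mul_pow_mul_teich_inv p k Ksep hN ?_)
  rw [coeffZero_uElt p k Ksep hN]
  exact pow_ne_zero _ (unif_ne_zero k Ksep)

/-- The ring `O_N(Ksep)` is a lift of `Ksep`. -/
theorem exists_mem_liftRing_coeffZero_eq [PerfectRing k p] (x : Ksep) :
    ∃ y ∈ liftRing p k Ksep N, coeffZero p hN Ksep y = x := by
  suffices h : Subring.closure (insert (unif k Ksep) (Set.range fun y : Ksep => y ^ p ^ (N - 1))) ≤
    (liftRing p k Ksep N).map (coeffZero p hN Ksep) from h (mem_closure_pow_unif p k Ksep (N - 1) x)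
  refine Subring.closure_le.2 ?_
  rintro y (rfl | ⟨z, rfl⟩)
  · exact ⟨uTop p k Ksep N, Subring.subset_closure (Set.mem_insert _ _),
      coeffZero_teich p N hN (unif k Ksep)⟩
  · refine ⟨teich p N z ^ p ^ (N - 1), teich_pow_mem_liftRing p k Ksep z, ?_⟩
    rw [map_pow, coeffZero_teich]

variable {p k Ksep}

theorem sepNorm_coeffZero_lt {x : TruncatedWittVector p N Ksep} (hx : x ∈ wittMax p k Ksep N) :
    sepNorm k (coeffZero p hN Ksep x) < 1 := by
  rw [coeffZero_eq]
  exact hx _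

theorem teich_mem_wittInt {x : Ksep} (hx : sepNorm k x ≤ 1) : teich p N x ∈ wittInt p k Ksep N := by
  intro i
  rw [teich_apply, WittVector.coeff_truncate]
  rcases Nat.eq_zero_or_pos (i : ℕ) with hi | hi
  · rwa [hi, WittVector.teichmuller_coeff_zero]
  · rw [WittVector.teichmuller_coeff_pos p _ _ hi, sepNorm_zero]
    exact zero_le_one

theorem teich_mem_wittMax {x : Ksep} (hx : sepNorm k x < 1) : teich p N x ∈ wittMax p k Ksep N := by
  intro i
  rw [teich_apply, WittVector.coeff_truncate]
  rcases Nat.eq_zero_or_pos (i : ℕ) with hi | hi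
  · rwa [hi, WittVector.teichmuller_coeff_zero]
  · rw [WittVector.teichmuller_coeff_pos p _ _ hi, sepNorm_zero]
    exact one_pos

theorem sepNorm_one_add {x : Ksep} (hx : sepNorm k x < 1) : sepNorm k (1 + x) = 1 := by
  refine le_antisymm ((sepNorm_add_le k 1 x).trans (by rw [sepNorm_one]; exact max_le le_rfl hx.le))
    ?_
  have h := sepNorm_sub_le k (1 + x) x
  rw [add_sub_cancel_right, sepNorm_one] at h
  exact (le_max_iff.1 h).resolve_right (not_le.2 hx)

include hN in
/-- Elements of `1 + W_N(m_sep)` are units of `W_N(O_sep)`. -/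
theorem exists_one_add_mul_eq_one {x : TruncatedWittVector p N Ksep}
    (hx : x ∈ wittMax p k Ksep N) : ∃ y ∈ wittInt p k Ksep N, (1 + x) * y = 1 := by
  have h1 : sepNorm k (coeffZero p hN Ksep (1 + x)) = 1 := by
    rw [map_add, map_one]
    exact sepNorm_one_add (sepNorm_coeffZero_lt hN hx)
  have h0 : coeffZero p hN Ksep (1 + x) ≠ 0 := by
    intro h
    rw [h, sepNorm_zero] at h1
    exact zero_ne_one h1
  have h2 := mul_pow_mul_teich_inv p k Ksep hN h0
  refine ⟨_, mem_of_mul_eq_one p k Ksep hN (add_mem (one_mem _) (wittMax_le_wittInt hx)) h2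
    (pow_mem (teich_mem_wittInt ?_) _), h2⟩
  rw [sepNorm_inv, h1, inv_one]

variable {τ : RingAut Ksep}

theorem wittAct_one (x : TruncatedWittVector p N Ksep) : wittAct p N (1 : RingAut Ksep) x = x := by
  ext i
  rw [coeff_wittAct, RingAut.one_apply]

theorem wittAct_mul (τ τ' : RingAut Ksep) (x : TruncatedWittVector p N Ksep) :
    wittAct p N (τ * τ') x = wittAct p N τ (wittAct p N τ' x) := by
  ext i
  rw [coeff_wittAct, coeff_wittAct, coeff_wittAct, RingAut.mul_apply]

theorem wittAct_twMap_frobSep_pow (n : ℕ) (x : TruncatedWittVector p N Ksep) :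
    wittAct p N τ (twMap p N (frobSep p k Ksep ^ n) x) =
      twMap p N (frobSep p k Ksep ^ n) (wittAct p N τ x) := by
  ext i
  rw [coeff_wittAct, coeff_twMap, coeff_twMap, coeff_wittAct, frobSep_pow_apply,
    frobSep_pow_apply, map_pow]

theorem sigma_wittAct (x : TruncatedWittVector p N Ksep) :
    sigma p k Ksep N (wittAct p N τ x) = wittAct p N τ (sigma p k Ksep N x) := by
  have h := wittAct_twMap_frobSep_pow (p := p) (k := k) (τ := τ) 1 x
  rw [pow_one] at h
  exact h.symm

theorem wittAct_teich (x : Ksep) : wittAct p N τ (teich p N x) = teich p N (τ x) :=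
  twMap_teich p N _ x

theorem wittAct_mem_wittInt (hτ : τ ∈ autGroup k Ksep) {x : TruncatedWittVector p N Ksep}
    (hx : x ∈ wittInt p k Ksep N) : wittAct p N τ x ∈ wittInt p k Ksep N := by
  intro i
  rw [coeff_wittAct, hτ.1]
  exact hx i

theorem wittAct_mem_wittMax (hτ : τ ∈ autGroup k Ksep) {x : TruncatedWittVector p N Ksep}
    (hx : x ∈ wittMax p k Ksep N) : wittAct p N τ x ∈ wittMax p k Ksep N := by
  intro i
  rw [coeff_wittAct, hτ.1]
  exact hx i

theorem wittAct_uElt_one :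
    wittAct p N τ (uElt p k Ksep N 1) = (lubinTateP p)^[N - 1] (teich p N (τ (unif k Ksep))) := by
  rw [uElt, map_lubinTateP_iterate, ← wittAct_teich]
  rfl

include hN in
-- The Teichmüller element of `τ ũ` need not lie in `O_N(Ksep)`, but `[p ^ (N - 1)]` sees only first
-- coordinates, so it may be replaced by a lift of `τ ũ` that does.
theorem wittAct_uElt_one_mem_liftRing [PerfectRing k p] :
    wittAct p N τ (uElt p k Ksep N 1) ∈ liftRing p k Ksep N := by
  obtain ⟨y, hy, hy'⟩ := exists_mem_liftRing_coeffZero_eq p k Ksep hN (τ (unif k Ksep))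
  rw [wittAct_uElt_one, ← lubinTateP_iterate_eq p k Ksep hN (x := y)
    (by rw [hy', coeffZero_teich])]
  induction N - 1 with
  | zero => exact hy
  | succ n ih =>
    rw [Function.iterate_succ_apply']
    exact lubinTateP_mem p ih

include hN in
theorem wittAct_mem_liftRing [PerfectRing k p] {x : TruncatedWittVector p N Ksep}
    (hx : x ∈ frobRing p k Ksep N (N - 1)) : wittAct p N τ x ∈ liftRing p k Ksep N := by
  suffices h : frobRing p k Ksep N (N - 1) ≤ (liftRing p k Ksep N).comap (wittAct p N τ) from h hx
  refine Subring.closure_le.2 ?_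
  rintro y (rfl | ⟨z, rfl⟩)
  · exact wittAct_uElt_one_mem_liftRing hN
  · change wittAct p N τ (twMap p N (frobSep p k Ksep ^ (N - 1)) z) ∈ liftRing p k Ksep N
    rw [wittAct_twMap_frobSep_pow]
    exact twMap_mem_liftRing p k Ksep _

include hN in
/-- If `τ ũ ≡ ũ` modulo `ũ ^ ((a + 1) p ^ (N - 1)) m_sep`, then `τ u_1 ≡ u_1` modulo
`u_1 ^ (a + 1) W_N(m_sep)`. -/
theorem exists_wittAct_uElt_one_eq {a : ℕ} {w : Ksep} (hw : sepNorm k w < 1)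
    (h : τ (unif k Ksep) = unif k Ksep + unif k Ksep ^ ((a + 1) * p ^ (N - 1)) * w) :
    ∃ z ∈ wittMax p k Ksep N, wittAct p N τ (uElt p k Ksep N 1) =
      uElt p k Ksep N 1 + uElt p k Ksep N 1 ^ (a + 1) * z := by
  have hu0 := sigma_uElt_one p k Ksep hN
  have hx : teich p N (unif k Ksep) ∈ wittInt p k Ksep N :=
    wittMax_le_wittInt uTop_mem_wittMax
  have hw1 : teich p N w ∈ wittMax p k Ksep N := teich_mem_wittMax hw
  have hy : uElt p k Ksep N 1 ^ (a + 1) * teich p N w ∈ wittInt p k Ksep N :=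
    mul_mem (pow_mem (wittMax_le_wittInt (uElt_mem_wittMax 1)) _) (wittMax_le_wittInt hw1)
  -- The argument on the right has first coordinate `τ ũ`, as `u_1` reduces to `ũ ^ (p ^ (N - 1))`;
  -- this is where the exponent `(a + 1) p ^ (N - 1)` comes from.
  have h1 : wittAct p N τ (uElt p k Ksep N 1) = (lubinTateP p)^[N - 1]
      (teich p N (unif k Ksep) + uElt p k Ksep N 1 ^ (a + 1) * teich p N w) := by
    rw [wittAct_uElt_one]
    apply lubinTateP_iterate_eq p k Ksep hN
    rw [map_add, map_mul, map_pow, coeffZero_teich, coeffZero_teich, coeffZero_teich,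
      coeffZero_uElt, h, ← pow_mul, mul_comm (p ^ (N - 1))]
  -- Divisibility is taken inside `W_N(O_sep)`, so that the quotient `g` is integral and `g` times
  -- the Teichmüller element of `w` lies in `W_N(m_sep)`.
  obtain ⟨g, hg⟩ := sub_dvd_lubinTateP_iterate_sub p (N - 1)
    (⟨_, add_mem hx hy⟩ : wittInt p k Ksep N) ⟨_, hx⟩
  have hg' := congrArg (wittInt p k Ksep N).subtype hg
  simp only [map_sub, map_mul, map_lubinTateP_iterate] at hg'
  simp only [Subring.subtype_apply, add_sub_cancel_left] at hg'
  rw [← h1] at hg'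
  have h2 : uElt p k Ksep N 1 = (lubinTateP p)^[N - 1] (teich p N (unif k Ksep)) := rfl
  rw [← h2] at hg'
  refine ⟨g * teich p N w, mul_mem_wittMax g.2 hw1, ?_⟩
  rw [← sub_eq_iff_eq_add', hg']
  ring

end Lift

/-! ### The action on `u_0` and `t`. -/

section Main

variable {p : ℕ} [Fact p.Prime] {k : Type*} [Field k] [CharP k p] [PerfectRing k p]
  {Ksep : Type*} [Field Ksep] [Algebra k⸨X⸩ Ksep] [IsSepClosure k⸨X⸩ Ksep]
  {N a : ℕ} (hN : 1 ≤ N) {v : ℝ} {τ : RingAut Ksep}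

theorem pos_of_lt_ramification (hv : ((a : ℝ) + 1) * (p : ℝ) ^ (N - 1) - 1 < v) : 0 < v := by
  have hp : (1 : ℝ) ≤ p := by exact_mod_cast (Fact.out : p.Prime).one_le
  have h1 : (1 : ℝ) ≤ (p : ℝ) ^ (N - 1) := one_le_pow₀ hp
  have h2 : (0 : ℝ) ≤ a := Nat.cast_nonneg a
  nlinarith

include hN in
theorem mem_liftRing_of_uElt_zero_pow_mul {z : TruncatedWittVector p N Ksep}
    (hz : uElt p k Ksep N 0 ^ a * z ∈ liftRing p k Ksep N) : z ∈ liftRing p k Ksep N := by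
  obtain ⟨b, hb⟩ := (isUnit_uElt p k Ksep hN 0).exists_right_inv
  have hbl : b ∈ liftRing p k Ksep N := mem_of_mul_eq_one p k Ksep hN
    (uElt_mem_liftRing 0) hb (teich_pow_mem_liftRing p k Ksep _)
  have : z = b ^ a * (uElt p k Ksep N 0 ^ a * z) := by
    rw [← mul_assoc, ← mul_pow, mul_comm b, hb, one_pow, one_mul]
  rw [this]
  exact mul_mem (pow_mem hbl a) hz

include hN in
-- Since `u_0` is invertible in `O_N(Ksep)`, dividing by `u_0 ^ a` does not leave that ring.
-- Congruences may therefore be tested modulo `u_0 ^ a W_N(m_sep)`, which is convenient because `z`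
-- above is not known to lie in `O_N(Ksep)`.
theorem saMk_eq_iff {x y : liftInt p k Ksep N} :
    saMk p k Ksep N a x = saMk p k Ksep N a y ↔ ∃ z ∈ wittMax p k Ksep N,
      (x : TruncatedWittVector p N Ksep) - y = uElt p k Ksep N 0 ^ a * z := by
  rw [← sub_eq_zero, ← map_sub, saMk_eq_zero]
  constructor
  · rintro ⟨z, hz, h⟩
    exact ⟨z, hz, (congrArg Subtype.val h).symm⟩
  · rintro ⟨z, hz, h⟩
    have hzl : z ∈ liftRing p k Ksep N := mem_liftRing_of_uElt_zero_pow_mul hN (a := a)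
      (by rw [← h]; exact sub_mem x.2.1 y.2.1)
    exact ⟨⟨z, hzl, wittMax_le_wittInt hz⟩, hz, Subtype.ext h.symm⟩

include hN in
theorem wittAct_uElt_zero_mem_liftRing :
    wittAct p N τ (uElt p k Ksep N 0) ∈ liftRing p k Ksep N := by
  rw [uElt_zero_eq p k Ksep hN, lubinTateP, map_add, map_mul, map_pow, map_natCast]
  exact lubinTateP_mem p (wittAct_uElt_one_mem_liftRing hN)

section Action

variable (hv : ((a : ℝ) + 1) * (p : ℝ) ^ (N - 1) - 1 < v) (hτ : τ ∈ ramGroup k Ksep v)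

include hN hv hτ

theorem exists_wittAct_uElt_one_eq_of_mem_ramGroup : ∃ z ∈ wittMax p k Ksep N,
    wittAct p N τ (uElt p k Ksep N 1) = uElt p k Ksep N 1 + uElt p k Ksep N 1 ^ (a + 1) * z := by
  obtain ⟨w, hw, h⟩ := exists_apply_unif_eq_of_mem_ramGroup (pos_of_lt_ramification hv).le hτ
    (e := (a + 1) * p ^ (N - 1)) (by push_cast; linarith)
  exact exists_wittAct_uElt_one_eq hN hw h

/-- `τ u_0` is the product of `u_0` and a unit of `O_N^0`. -/
theorem exists_wittAct_uElt_zero_eq : ∃ c : (liftInt p k Ksep N)ˣ,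
    wittAct p N τ (uElt p k Ksep N 0) =
      uElt p k Ksep N 0 * ((c : liftInt p k Ksep N) : TruncatedWittVector p N Ksep) := by
  obtain ⟨z, hz, h⟩ := exists_wittAct_uElt_one_eq_of_mem_ramGroup hN hv hτ
  have h0 : wittAct p N τ (uElt p k Ksep N 0) =
      uElt p k Ksep N 0 * (1 + uElt p k Ksep N 0 ^ a * sigma p k Ksep N z) := by
    rw [← sigma_uElt_one p k Ksep hN, ← sigma_wittAct, h, map_add, map_mul, map_pow]
    ring
  have hmax : uElt p k Ksep N 0 ^ a * sigma p k Ksep N z ∈ wittMax p k Ksep N :=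
    mul_mem_wittMax (pow_mem (wittMax_le_wittInt (uElt_mem_wittMax 0)) a) (sigma_mem_wittMax hz)
  obtain ⟨d, hd, h1⟩ := exists_one_add_mul_eq_one hN hmax
  obtain ⟨b, hb⟩ := (isUnit_uElt p k Ksep hN 0).exists_right_inv
  have hbl : b ∈ liftRing p k Ksep N := mem_of_mul_eq_one p k Ksep hN
    (uElt_mem_liftRing 0) hb (teich_pow_mem_liftRing p k Ksep _)
  -- Integrality comes from the formula in `z`; membership in `O_N(Ksep)` comes instead from writing
  -- the same element as `τ u_0 / u_0`.
  have hcl : 1 + uElt p k Ksep N 0 ^ a * sigma p k Ksep N z ∈ liftRing p k Ksep N := by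
    have : 1 + uElt p k Ksep N 0 ^ a * sigma p k Ksep N z =
        wittAct p N τ (uElt p k Ksep N 0) * b := by
      rw [h0, mul_right_comm, hb, one_mul]
    rw [this]
    exact mul_mem (wittAct_uElt_zero_mem_liftRing hN) hbl
  have hdl : d ∈ liftRing p k Ksep N := mem_of_mul_eq_one p k Ksep hN hcl h1
    (teich_pow_mem_liftRing p k Ksep _)
  refine ⟨⟨⟨_, hcl, add_mem (one_mem _) (wittMax_le_wittInt hmax)⟩, ⟨d, hdl, hd⟩,
    Subtype.ext h1, Subtype.ext ((mul_comm _ _).trans h1)⟩, h0⟩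

/-- `τ t` is the product of `t` and an element `c` of `O_N^0` with `σ c ≡ 1` modulo
`u_0 ^ a O_N^+`. -/
theorem exists_wittAct_tElt_eq : ∃ c : liftInt p k Ksep N,
    wittAct p N τ (tElt p k Ksep N) = tElt p k Ksep N * c ∧
    saMk p k Ksep N a (sigmaInt p k Ksep N c) = 1 := by
  obtain ⟨z, hz, h⟩ := exists_wittAct_uElt_one_eq_of_mem_ramGroup hN hv hτ
  obtain ⟨t', ht'⟩ := (isUnit_tElt p k Ksep (N := N)).exists_right_inv
  have htl : tElt p k Ksep N ∈ liftRing p k Ksep N := by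
    rw [← coe_tInt]
    exact (tInt p k Ksep N).2.1
  have hτl : wittAct p N τ (tElt p k Ksep N) ∈ liftRing p k Ksep N := by
    rw [tElt, map_add, map_pow, map_natCast]
    exact add_mem (natCast_mem _ p) (pow_mem (wittAct_uElt_one_mem_liftRing hN) _)
  have ht'l : t' ∈ liftRing p k Ksep N := mem_of_mul_eq_one p k Ksep hN htl ht'
    (teich_pow_mem_liftRing p k Ksep _)
  have h1i := wittMax_le_wittInt (uElt_mem_wittMax (p := p) (k := k) (Ksep := Ksep) (N := N) 1)
  have h0i := wittMax_le_wittInt (uElt_mem_wittMax (p := p) (k := k) (Ksep := Ksep) (N := N) 0)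
  obtain ⟨d, hd, h1⟩ := exists_one_add_mul_eq_one hN (mul_mem_wittMax (pow_mem h1i a) hz)
  have hσz := sigma_mem_wittMax hz
  -- Computing `τ u_0` once from `σ u_1 = u_0` and once from `u_0 = t u_1` gives `c = (1 + u_0 ^ a σ
  -- z) / (1 + u_1 ^ a z)`, with `d` the inverse of the denominator.
  have hc : t' * wittAct p N τ (tElt p k Ksep N) =
      (1 + uElt p k Ksep N 0 ^ a * sigma p k Ksep N z) * d := by
    have e1 : wittAct p N τ (uElt p k Ksep N 0) =
        uElt p k Ksep N 0 * (1 + uElt p k Ksep N 0 ^ a * sigma p k Ksep N z) := by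
      rw [← sigma_uElt_one p k Ksep hN, ← sigma_wittAct, h, map_add, map_mul, map_pow]
      ring
    have e2 : wittAct p N τ (uElt p k Ksep N 0) = wittAct p N τ (tElt p k Ksep N) *
        (uElt p k Ksep N 1 * (1 + uElt p k Ksep N 1 ^ a * z)) := by
      rw [uElt_zero p k Ksep hN, map_mul, h]
      ring
    apply (isUnit_uElt p k Ksep hN 0).mul_left_cancel
    rw [← mul_assoc (uElt p k Ksep N 0) (1 + _), ← e1, e2, uElt_zero p k Ksep hN]
    linear_combination (uElt p k Ksep N 1 * wittAct p N τ (tElt p k Ksep N)) * (ht' - h1)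
  have hci : t' * wittAct p N τ (tElt p k Ksep N) ∈ wittInt p k Ksep N := by
    rw [hc]
    exact mul_mem (add_mem (one_mem _) (wittMax_le_wittInt (mul_mem_wittMax (pow_mem h0i a) hσz)))
      hd
  have hcl : t' * wittAct p N τ (tElt p k Ksep N) ∈ liftRing p k Ksep N := mul_mem ht'l hτl
  refine ⟨⟨_, hcl, hci⟩, by rw [← mul_assoc, ht', one_mul], ?_⟩
  rw [← map_one (saMk p k Ksep N a), saMk_eq_iff hN]
  have hr : (p : TruncatedWittVector p N Ksep) + uElt p k Ksep N 0 ^ (p - 1) ∈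
      wittInt p k Ksep N := add_mem (natCast_mem _ p) (pow_mem h0i _)
  -- Since `u_0` divides `σ u_0`, the numerator of `σ c` is `1` modulo `u_0 ^ a`; so is its
  -- denominator `1 + u_0 ^ a σ z`.
  have hσ0 : sigma p k Ksep N (uElt p k Ksep N 0) =
      uElt p k Ksep N 0 * (p + uElt p k Ksep N 0 ^ (p - 1)) := by
    have hp : p ≠ 0 := (Fact.out : p.Prime).ne_zero
    conv_lhs => rw [uElt_zero_eq p k Ksep hN, lubinTateP, map_add, map_mul, map_pow, map_natCast,
      sigma_uElt_one p k Ksep hN]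
    rw [mul_add, mul_pow_sub_one hp, mul_comm]
  have hd1 := congrArg (sigma p k Ksep N) h1
  rw [map_mul, map_add, map_mul, map_pow, map_one, sigma_uElt_one p k Ksep hN] at hd1
  refine ⟨sigma p k Ksep N d * ((p + uElt p k Ksep N 0 ^ (p - 1)) ^ a *
      sigma p k Ksep N (sigma p k Ksep N z) - sigma p k Ksep N z),
    mul_mem_wittMax (sigma_mem_wittInt hd)
      (sub_mem (mul_mem_wittMax (pow_mem hr a) (sigma_mem_wittMax hσz)) hσz), ?_⟩
  change sigma p k Ksep N (t' * wittAct p N τ (tElt p k Ksep N)) - 1 = _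
  rw [hc, map_mul, map_add, map_one, map_mul, map_pow, hσ0, mul_pow]
  linear_combination hd1

theorem wittAct_coeffHom (w : WittVector p k) :
    wittAct p N τ (coeffHom p k Ksep N w : TruncatedWittVector p N Ksep) =
      coeffHom p k Ksep N w := by
  change wittAct p N τ (WittVector.truncate N (WittVector.map (constHom k Ksep) w)) =
    WittVector.truncate N (WittVector.map (constHom k Ksep) w)
  ext i
  rw [coeff_wittAct, WittVector.coeff_truncate, WittVector.map_coeff,
    apply_constHom_of_mem_ramGroup p (pos_of_lt_ramification hv) hτ]

end Action

/-! ### Representatives of the values of morphisms. -/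

theorem coeffHom_mem_frobRing (n : ℕ) (w : WittVector p k) :
    (coeffHom p k Ksep N w : TruncatedWittVector p N Ksep) ∈ frobRing p k Ksep N n := by
  have h : (coeffHom p k Ksep N w : TruncatedWittVector p N Ksep) =
      twMap p N (frobSep p k Ksep ^ n) (WittVector.truncate N (WittVector.map
        ((constHom k Ksep).comp ((iterateFrobeniusEquiv k p n).symm : k →+* k)) w)) := by
    change WittVector.truncate N (WittVector.map (constHom k Ksep) w) = _
    ext i
    rw [coeff_twMap, WittVector.coeff_truncate, WittVector.coeff_truncate,
      WittVector.map_coeff, WittVector.map_coeff, frobSep_pow_apply, RingHom.comp_apply, ← map_pow]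
    congr 1
    rw [← iterateFrobenius_def]
    exact ((iterateFrobeniusEquiv k p n).apply_symm_apply _).symm
  rw [h]
  exact twMap_mem_frobRing p k Ksep n _

include hN in
/-- An element of `Fil^i S_a` with a representative `y` in `W_N(σ ^ n Ksep)[u_1]` is the class of
`t ^ i x` for some `x` in the same ring. -/
theorem exists_tInt_pow_mul_eq {n i : ℕ} (hn : n ≤ N - 1) (hi : i ≤ a) {y : liftInt p k Ksep N}
    (hy : (y : TruncatedWittVector p N Ksep) ∈ frobRing p k Ksep N n)
    (h : saMk p k Ksep N a y ∈ saFil p k Ksep N a i) : ∃ x : liftInt p k Ksep N,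
      (x : TruncatedWittVector p N Ksep) ∈ frobRing p k Ksep N n ∧
      tInt p k Ksep N ^ i * x = y := by
  obtain ⟨x, hx⟩ := (mem_saFil hi).1 h
  obtain ⟨z, -, hz⟩ := saMk_eq_zero.1 (show saMk p k Ksep N a (y - tInt p k Ksep N ^ i * x) = 0 by
    rw [map_sub, hx, sub_self])
  obtain ⟨j, rfl⟩ := Nat.exists_eq_add_of_le hi
  -- The error `u_0 ^ a z = t ^ a u_1 ^ a z` is divisible by `t ^ i` because `i ≤ a`, so correcting
  -- `x` turns the congruence into an equality. Then `x = t ^ (-i) y`, and `t ^ (-1)` lies in the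
  -- ring.
  have hxy : tInt p k Ksep N ^ i *
      (x + tInt p k Ksep N ^ j * uInt p k Ksep N 1 ^ (i + j) * z) = y := by
    rw [uInt_zero hN] at hz
    linear_combination hz
  refine ⟨_, ?_, hxy⟩
  obtain ⟨t', ht'⟩ := (isUnit_tElt p k Ksep (N := N)).exists_right_inv
  have ht'n : t' ∈ frobRing p k Ksep N n := mem_of_mul_eq_one p k Ksep hN
    (tElt_mem_frobRing p k Ksep n) ht' (teich_pow_mem_frobRing p k Ksep hn _)
  have e := congrArg (fun b : liftInt p k Ksep N => t' ^ i * (b : TruncatedWittVector p N Ksep)) hxy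
  simp only [Subring.coe_mul, SubmonoidClass.coe_pow, coe_tInt] at e
  rw [← mul_assoc, ← mul_pow, mul_comm t', ht', one_pow, one_mul] at e
  rw [e]
  exact mul_mem (pow_mem ht'n i) hy

theorem eq_zero_of_mem_fil {M : Type*} [AddCommGroup M] [Module (WittVector p k) M]
    {A : FilteredModule p k M} (hA : A.IsFontaineLaffaille N a) {i : ℕ} (hi : a < i)
    {m : M} (hm : m ∈ A.fil i) : m = 0 := by
  have h := antitone_nat_of_succ_le A.fil_succ_le (Nat.succ_le_of_lt hi) hm
  rw [Nat.succ_eq_add_one, hA.fil_eq_bot] at h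
  exact (Submodule.mem_bot _).1 h

/-- The values of morphisms from a Fontaine-Laffaille module to `S_a` have representatives in
`W_N(σ ^ n Ksep)[u_1]`. -/
theorem exists_saMk_eq_of_mem_frobRing (ha : a + 2 ≤ p) {M : Type*} [AddCommGroup M]
    [Module (WittVector p k) M] {A : FilteredModule p k M} (hA : A.IsFontaineLaffaille N a)
    (ξ : UTilde p k Ksep hN ha A) (n : ℕ) (hn : n ≤ N - 1) (m : M) : ∃ x : liftInt p k Ksep N,
      (x : TruncatedWittVector p N Ksep) ∈ frobRing p k Ksep N n ∧
      saMk p k Ksep N a x = ξ.1 m := by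
  -- For `n = 0` there is no condition, since `W_N(Ksep)` is everything. In the step, `ξ (φ_i b) =
  -- φ_i (ξ b)` is the class of `σ x`, where `t ^ i x` represents `ξ b`; the generators `b` vary,
  -- hence the general `m`.
  induction n generalizing m with
  | zero =>
    obtain ⟨x, hx⟩ := saMk_surjective (ξ.1 m)
    refine ⟨x, Subring.subset_closure (Set.mem_insert_of_mem _ ⟨x, ?_⟩), hx⟩
    ext i
    rw [coeff_twMap, frobSep_pow_apply, pow_zero, pow_one]
  | succ n ih =>
    have hm : m ∈ Submodule.span (WittVector p k) (⋃ i, Set.range (A.phi i)) := by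
      rw [hA.span_range]; trivial
    induction hm using Submodule.span_induction with
    | mem m hm =>
      obtain ⟨i, ⟨b, hb⟩, rfl⟩ := Set.mem_iUnion.1 hm
      obtain ⟨hfil, hphi⟩ := ξ.2
      rw [hphi i ⟨b, hb⟩]
      by_cases hi : i ≤ a
      · obtain ⟨y, hy, hyb⟩ := ih (by omega) b
        obtain ⟨x, hx, hxy⟩ := exists_tInt_pow_mul_eq hN (by omega) hi hy
          (by rw [hyb]; exact hfil i b hb)
        exact ⟨sigmaInt p k Ksep N x, sigma_mem_frobRing p k Ksep hN hx,
          (saPhiFun_eq hN hi _ x (by rw [hxy, hyb])).symm⟩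
      · exact ⟨0, zero_mem _, by
          rw [map_zero]; exact (saPhiFun_of_lt hN (not_le.1 hi) _).symm⟩
    | zero => exact ⟨0, zero_mem _, by rw [map_zero, map_zero]⟩
    | add m m' _ _ hm hm' =>
      obtain ⟨x, hx, h⟩ := hm
      obtain ⟨x', hx', h'⟩ := hm'
      exact ⟨x + x', add_mem hx hx', by rw [map_add, map_add, h, h']⟩
    | smul w m _ hm =>
      obtain ⟨x, hx, h⟩ := hm
      exact ⟨w • x, mul_mem (coeffHom_mem_frobRing (n + 1) w) hx, by
        rw [map_smul, map_smul, h]⟩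

/-! ### Transport of classes by `τ`, and the action on morphisms. -/

variable (p N a) in
/-- The relation on `S_a` induced by the action of `τ` on `W_N(Ksep)`. -/
def SaRel (τ : RingAut Ksep) (s s' : Sa p k Ksep N a) : Prop :=
  ∃ x y : liftInt p k Ksep N, saMk p k Ksep N a x = s ∧ saMk p k Ksep N a y = s' ∧
    ∃ z ∈ wittMax p k Ksep N,
      wittAct p N τ (x : TruncatedWittVector p N Ksep) - y = uElt p k Ksep N 0 ^ a * z

theorem SaRel.one (s : Sa p k Ksep N a) : SaRel p N a 1 s s := by
  obtain ⟨x, rfl⟩ := saMk_surjective s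
  exact ⟨x, x, rfl, rfl, 0, zero_mem _, by rw [wittAct_one, sub_self, mul_zero]⟩

theorem SaRel.add {s₁ s₂ s₁' s₂' : Sa p k Ksep N a} (h₁ : SaRel p N a τ s₁ s₁')
    (h₂ : SaRel p N a τ s₂ s₂') : SaRel p N a τ (s₁ + s₂) (s₁' + s₂') := by
  obtain ⟨x₁, y₁, rfl, rfl, z₁, hz₁, h₁⟩ := h₁
  obtain ⟨x₂, y₂, rfl, rfl, z₂, hz₂, h₂⟩ := h₂
  refine ⟨x₁ + x₂, y₁ + y₂, map_add _ _ _, map_add _ _ _, z₁ + z₂, add_mem hz₁ hz₂, ?_⟩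
  rw [Subring.coe_add, Subring.coe_add, map_add, mul_add, ← h₁, ← h₂]
  ring

section Action

variable (hv : ((a : ℝ) + 1) * (p : ℝ) ^ (N - 1) - 1 < v) (hτ : τ ∈ ramGroup k Ksep v)

include hN hv hτ

theorem exists_wittAct_uElt_zero_pow_mul_eq {z : TruncatedWittVector p N Ksep}
    (hz : z ∈ wittMax p k Ksep N) : ∃ z' ∈ wittMax p k Ksep N,
      wittAct p N τ (uElt p k Ksep N 0 ^ a * z) = uElt p k Ksep N 0 ^ a * z' := by
  obtain ⟨c, hc⟩ := exists_wittAct_uElt_zero_eq hN hv hτ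
  refine ⟨((c : liftInt p k Ksep N) : TruncatedWittVector p N Ksep) ^ a * wittAct p N τ z,
    mul_mem_wittMax (pow_mem (c : liftInt p k Ksep N).2.2 a) (wittAct_mem_wittMax hτ.1 hz), ?_⟩
  rw [map_mul, map_pow, hc]
  ring

/-- Independence of representatives: `W_N(τ)` sends `u_0 ^ a W_N(m_sep)` into itself, as `τ u_0` is
a unit multiple of `u_0`. -/
theorem SaRel.exists_of_saMk_eq {s s' : Sa p k Ksep N a} (h : SaRel p N a τ s s')
    {x y : liftInt p k Ksep N} (hx : saMk p k Ksep N a x = s) (hy : saMk p k Ksep N a y = s') :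
    ∃ z ∈ wittMax p k Ksep N,
      wittAct p N τ (x : TruncatedWittVector p N Ksep) - y = uElt p k Ksep N 0 ^ a * z := by
  obtain ⟨x', y', hx', hy', z, hz, h⟩ := h
  obtain ⟨z₁, hz₁, h₁⟩ := (saMk_eq_iff hN).1 (hx.trans hx'.symm)
  obtain ⟨z₂, hz₂, h₂⟩ := (saMk_eq_iff hN).1 (hy'.trans hy.symm)
  obtain ⟨z₃, hz₃, h₃⟩ := exists_wittAct_uElt_zero_pow_mul_eq hN hv hτ hz₁
  rw [← h₁, map_sub] at h₃
  exact ⟨z₃ + z + z₂, add_mem (add_mem hz₃ hz) hz₂, by linear_combination h₃ + h + h₂⟩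

/-- The relation is thus a partial function on `S_a`. It need not be defined everywhere, since
`W_N(τ)` may move a representative out of `O_N(Ksep)`. -/
theorem SaRel.unique {s s₁ s₂ : Sa p k Ksep N a} (h₁ : SaRel p N a τ s s₁)
    (h₂ : SaRel p N a τ s s₂) : s₁ = s₂ := by
  obtain ⟨x, rfl⟩ := saMk_surjective s
  obtain ⟨y₁, rfl⟩ := saMk_surjective s₁
  obtain ⟨y₂, rfl⟩ := saMk_surjective s₂
  obtain ⟨z₁, hz₁, e₁⟩ := h₁.exists_of_saMk_eq hN hv hτ rfl rfl
  obtain ⟨z₂, hz₂, e₂⟩ := h₂.exists_of_saMk_eq hN hv hτ rfl rfl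
  exact (saMk_eq_iff hN).2 ⟨z₂ - z₁, sub_mem hz₂ hz₁, by linear_combination e₂ - e₁⟩

theorem SaRel.smul {s s' : Sa p k Ksep N a} (w : WittVector p k) (h : SaRel p N a τ s s') :
    SaRel p N a τ (w • s) (w • s') := by
  obtain ⟨x, y, rfl, rfl, z, hz, h⟩ := h
  refine ⟨w • x, w • y, map_smul _ _ _, map_smul _ _ _,
    (coeffHom p k Ksep N w : TruncatedWittVector p N Ksep) * z,
    mul_mem_wittMax (coeffHom p k Ksep N w).2.2 hz, ?_⟩
  change wittAct p N τ ((coeffHom p k Ksep N w : TruncatedWittVector p N Ksep) * x) -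
    (coeffHom p k Ksep N w : TruncatedWittVector p N Ksep) * y = _
  rw [map_mul, wittAct_coeffHom hN hv hτ, ← mul_sub, h]
  ring

theorem SaRel.mul {τ' : RingAut Ksep} {s s' s'' : Sa p k Ksep N a} (h : SaRel p N a τ' s s')
    (h' : SaRel p N a τ s' s'') : SaRel p N a (τ * τ') s s'' := by
  obtain ⟨x, y, rfl, rfl, z, hz, h⟩ := h
  obtain ⟨y', rfl⟩ := saMk_surjective s''
  obtain ⟨z', hz', h'⟩ := h'.exists_of_saMk_eq hN hv hτ rfl rfl
  obtain ⟨z₁, hz₁, h₁⟩ := exists_wittAct_uElt_zero_pow_mul_eq hN hv hτ hz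
  rw [← h, map_sub] at h₁
  refine ⟨x, y', rfl, rfl, z₁ + z', add_mem hz₁ hz', ?_⟩
  rw [wittAct_mul]
  linear_combination h₁ + h'

/-- The action of `τ` on elements of `Fil^i S_a` with a representative in
`W_N(σ ^ (N - 1) Ksep)[u_1]` respects the filtration and the maps `φ_i`. -/
theorem exists_saRel_saPhiFun {i : ℕ} (hi : i ≤ a) {y : liftInt p k Ksep N}
    (hy : (y : TruncatedWittVector p N Ksep) ∈ frobRing p k Ksep N (N - 1))
    (h : saMk p k Ksep N a y ∈ saFil p k Ksep N a i) :
    ∃ (s : Sa p k Ksep N a) (hs : s ∈ saFil p k Ksep N a i),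
      SaRel p N a τ (saMk p k Ksep N a y) s ∧
      SaRel p N a τ (saPhiFun hN i ⟨saMk p k Ksep N a y, h⟩) (saPhiFun hN i ⟨s, hs⟩) := by
  obtain ⟨x, hx, rfl⟩ := exists_tInt_pow_mul_eq hN le_rfl hi hy h
  obtain ⟨c, hc, hσc⟩ := exists_wittAct_tElt_eq hN hv hτ
  let x' : liftInt p k Ksep N := ⟨wittAct p N τ (x : TruncatedWittVector p N Ksep),
    wittAct_mem_liftRing hN hx, wittAct_mem_wittInt hτ.1 x.2.2⟩
  -- This is `τ (t ^ i x) = t ^ i c ^ i τ x`. Its image under `φ_i` is the class of `σ(c) ^ i σ(τ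
  -- x)`, and `σ c ≡ 1` leaves `τ (σ x)`.
  refine ⟨saMk p k Ksep N a (tInt p k Ksep N ^ i * (c ^ i * x')), (mem_saFil hi).2 ⟨_, rfl⟩,
    ⟨_, _, rfl, rfl, 0, zero_mem _, ?_⟩, ?_⟩
  · simp only [Subring.coe_mul, SubmonoidClass.coe_pow, coe_tInt, map_mul, map_pow, hc, x']
    ring
  · rw [saPhiFun_eq hN hi _ x rfl, saPhiFun_eq hN hi _ (c ^ i * x') rfl, map_mul, map_mul,
      map_pow, map_pow, hσc, one_pow, one_mul]
    refine ⟨_, _, rfl, rfl, 0, zero_mem _, ?_⟩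
    rw [mul_zero, sub_eq_zero]
    exact (sigma_wittAct (k := k) (x : TruncatedWittVector p N Ksep)).symm

/-- Good representatives show that each value of `ξ` can be transported; uniqueness of the result
makes the choice linear and compatible with the filtrations and the `φ_i`. -/
theorem exists_uTilde_saRel (ha : a + 2 ≤ p) {M : Type*} [AddCommGroup M]
    [Module (WittVector p k) M] {A : FilteredModule p k M} (hA : A.IsFontaineLaffaille N a)
    (ξ : UTilde p k Ksep hN ha A) :
    ∃ η : UTilde p k Ksep hN ha A, ∀ m, SaRel p N a τ (ξ.1 m) (η.1 m) := by
  have hrep : ∀ m, ∃ s, SaRel p N a τ (ξ.1 m) s := by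
    intro m
    obtain ⟨x, hx, h⟩ := exists_saMk_eq_of_mem_frobRing hN ha hA ξ (N - 1) le_rfl m
    exact ⟨saMk p k Ksep N a ⟨wittAct p N τ (x : TruncatedWittVector p N Ksep),
      wittAct_mem_liftRing hN hx, wittAct_mem_wittInt hτ.1 x.2.2⟩,
      x, _, h, rfl, 0, zero_mem _, by rw [mul_zero, sub_self]⟩
  choose f hf using hrep
  let η : M →ₗ[WittVector p k] Sa p k Ksep N a :=
    { toFun := f
      map_add' := fun m m' => SaRel.unique hN hv hτ (hf (m + m'))
        (by rw [map_add]; exact (hf m).add (hf m'))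
      map_smul' := fun w m => SaRel.unique hN hv hτ (hf (w • m))
        (by rw [map_smul]; exact (hf m).smul hN hv hτ w) }
  obtain ⟨hfil, hphi⟩ := ξ.2
  have key : ∀ i (m : M) (hm : m ∈ A.fil i), ∃ h : η m ∈ saFil p k Ksep N a i,
      η (A.phi i ⟨m, hm⟩) = saPhiFun hN i ⟨η m, h⟩ := by
    intro i m hm
    by_cases hi : i ≤ a
    · obtain ⟨y, hy, h⟩ := exists_saMk_eq_of_mem_frobRing hN ha hA ξ (N - 1) le_rfl m
      have hym : saMk p k Ksep N a y ∈ saFil p k Ksep N a i := by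
        rw [h]; exact hfil i m hm
      obtain ⟨s, hs, h₁, h₂⟩ := exists_saRel_saPhiFun hN hv hτ hi hy hym
      have hηm : η m = s := SaRel.unique hN hv hτ (hf m) (h ▸ h₁)
      subst hηm
      refine ⟨hs, SaRel.unique hN hv hτ (hf _) ?_⟩
      rw [hphi i ⟨m, hm⟩]
      convert h₂ using 1
      exact congrArg (saPhiFun hN i) (Subtype.ext h.symm)
    · have h0 := eq_zero_of_mem_fil hA (not_le.1 hi) hm
      subst h0
      refine ⟨by rw [map_zero]; exact zero_mem _, ?_⟩
      rw [saPhiFun_of_lt hN (not_le.1 hi), show (⟨0, hm⟩ : A.fil i) = 0 from rfl, map_zero,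
        map_zero]
  exact ⟨⟨η, fun i m hm => (key i m hm).1, fun i m => (key i m.1 m.2).2⟩, hf⟩

end Action

end Main

end FLRam

open FLRam in
theorem proposition2p1
    (p : ℕ) [Fact p.Prime]
    (k : Type*) [Field k] [CharP k p] [PerfectRing k p]
    (Ksep : Type*) [Field Ksep] [Algebra k⸨X⸩ Ksep] [IsSepClosure k⸨X⸩ Ksep]
    (N a : ℕ) (hN : 1 ≤ N) (ha : a + 2 ≤ p)
    (v : ℝ) (hv : ((a : ℝ) + 1) * (p : ℝ) ^ (N - 1) - 1 < v)
    {M : Type*} [AddCommGroup M] [Module (WittVector p k) M]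
    (A : FilteredModule p k M) (hA : A.IsFontaineLaffaille N a) :
    (∀ τ ∈ ramGroup k Ksep v, ∃ c : (liftInt p k Ksep N)ˣ,
      wittAct p N τ (uElt p k Ksep N 0) = uElt p k Ksep N 0 * ((c : liftInt p k Ksep N) : _)) ∧
    (∀ τ ∈ ramGroup k Ksep v, ∀ i ≤ a, ∃ z : liftInt p k Ksep N,
      (z : TruncatedWittVector p N Ksep) = wittAct p N τ (tElt p k Ksep N ^ i) ∧
      ∃ h : saMk p k Ksep N a z ∈ (saMF p k Ksep hN ha).fil i,
        (saMF p k Ksep hN ha).phi i ⟨saMk p k Ksep N a z, h⟩ = 1) ∧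
    ∃! ρ : ramGroup k Ksep v →* AddMonoid.End (UTilde p k Ksep hN ha A),
      ∀ (τ : ramGroup k Ksep v) (ξ : UTilde p k Ksep hN ha A) (m : M)
        (x y : liftInt p k Ksep N),
        saMk p k Ksep N a x = ξ.1 m → saMk p k Ksep N a y = (ρ τ ξ).1 m →
        ∃ z ∈ wittMax p k Ksep N,
          wittAct p N (τ : RingAut Ksep) (x : TruncatedWittVector p N Ksep) - y =
            uElt p k Ksep N 0 ^ a * z := by
  refine ⟨fun τ hτ => exists_wittAct_uElt_zero_eq hN hv hτ, fun τ hτ i hi => ?_, ?_⟩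
  · obtain ⟨c, hc, hσc⟩ := exists_wittAct_tElt_eq hN hv hτ
    refine ⟨tInt p k Ksep N ^ i * c ^ i, ?_, (mem_saFil hi).2 ⟨_, rfl⟩, ?_⟩
    · simp only [Subring.coe_mul, SubmonoidClass.coe_pow, coe_tInt, map_pow, hc, mul_pow]
    · refine (saPhiFun_eq hN hi _ (c ^ i) rfl).trans ?_
      rw [map_pow, map_pow, hσc, one_pow]
  · have hex := fun (τ : ramGroup k Ksep v) (ξ : UTilde p k Ksep hN ha A) =>
      exists_uTilde_saRel hN hv τ.2 ha hA ξ
    choose f hf using hex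
    -- A morphism related to `ξ` through `τ` is determined by this relation. Additivity, the laws of
    -- an action and uniqueness of the action are all instances.
    have huniq : ∀ (τ : ramGroup k Ksep v) (ξ η : UTilde p k Ksep hN ha A),
        (∀ m, SaRel p N a (τ : RingAut Ksep) (ξ.1 m) (η.1 m)) → f τ ξ = η :=
      fun τ ξ η h => Subtype.ext (LinearMap.ext fun m =>
        SaRel.unique hN hv τ.2 (hf τ ξ m) (h m))
    refine ⟨
      { toFun := fun τ => AddMonoidHom.mk' (f τ) fun ξ η => huniq τ _ _ fun m =>
          (hf τ ξ m).add (hf τ η m)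
        map_one' := AddMonoidHom.ext fun ξ => huniq 1 ξ ξ fun m => SaRel.one _
        map_mul' := fun τ τ' => AddMonoidHom.ext fun ξ => huniq (τ * τ') ξ _ fun m =>
          (hf τ' ξ m).mul hN hv τ.2 (hf τ (f τ' ξ) m) }, ?_, ?_⟩
    · intro τ ξ m x y hx hy
      exact (hf τ ξ m).exists_of_saMk_eq hN hv τ.2 hx hy
    · intro ρ hρ
      refine MonoidHom.ext fun τ => AddMonoidHom.ext fun ξ => (huniq τ ξ _ fun m => ?_).symm
      obtain ⟨x, hx⟩ := saMk_surjective (ξ.1 m)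
      obtain ⟨y, hy⟩ := saMk_surjective ((ρ τ ξ).1 m)
      exact ⟨x, y, hx, hy, hρ τ ξ m x y hx hy⟩
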